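/- Let $\mathbb D$ be the open unit disk of $\mathbb C$. For a sequence $\beta=(\beta_k)_{k\ge 0}$ of positive numbers with $\liminf_{k\to\infty}\beta_k^{1/k}\ge 1$ (the lower limit taken in $[0,\infty]$), let $H^2(\beta)$ be the Hilbert space of the functions $f(z)=\sum_{k\ge 0}c_kz^k$ on $\mathbb D$ with $\|f\|_{H^2(\beta)}^2:=\sum_{k\ge 0}\beta_k|c_k|^2<\infty$. For an analytic map $\varphi\colon\mathbb D\to\mathbb D$, let $C_\varphi^\beta$ denote the composition operator $f\mapsto f\circ\varphi$ on $H^2(\beta)$; it is called bounded if it maps $H^2(\beta)$ into itself and is bounded there. For a bounded operator $T$ on a Hilbert space and $n\ge 1$, let $a_n(T)=\inf\{\|T-R\| : R \text{ bounded},\ \operatorname{rank}R<n\}$. If $T$ is compact on an infinite-dimensional Hilbert space, its singular numbers are the terms of the non-increasing sequence $(s_n(T))_{n\ge1}$ of non-negative numbers tending to $0$ in a Schmidt decomposition $Tx=\sum_{n\ge 1}s_n(T)\langle x\mid v_n\rangle u_n$ with $(u_n)$ and $(v_n)$ orthonormal. For $p>0$, $S_p(H)$ is the set of compact operators $T$ on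 $H$ with $\sum_{n\ge 1}a_n(T)^p<\infty$. A sequence $(u_n)_{n\ge1}$ of non-negative numbers is log-subordinate to $(v_n)_{n\ge1}$ if $\prod_{j=1}^nu_j\le\prod_{j=1}^nv_j$ for all $n\ge 1$. **Theorem.** Let $\beta,\gamma$ be two sequences as above such that $(\beta_k/\gamma_k)_{k\ge 0}$ is non-decreasing. Then $H^2(\beta)\subseteq H^2(\gamma)$ with continuous inclusion. Let $\varphi\colon\mathbb D\to\mathbb D$ be analytic with $\varphi(0)=0$, and assume that $C_\varphi^\beta$ is bounded. Then: 1. $C_\varphi^\gamma$ is bounded and $\|C_\varphi^\gamma\|\le\|C_\varphi^\beta\|$; 2. if $C_\varphi^\beta$ is compact, so is $C_\varphi^\gamma$; 3. if $C_\varphi^\beta$ is compact, the sequence $(s_n(C_\varphi^\gamma))_{n\ge1}$ is log-subordinate to $(s_n(C_\varphi^\beta))_{n\ge1}$, and (a) $s_{2n}(C_\varphi^\gamma)\le\sqrt{s_1(C_\varphi^\beta)}\,\sqrt{s_n(C_\varphi^\beta)}$ for all $n\ge1$; without the compactness assumption, the same two statements hold with $a_n$ in place of $s_n$; (b) for every $p>0$,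 $C_\varphi^\beta\in S_p(H^2(\beta))$ implies $C_\varphi^\gamma\in S_p(H^2(\gamma))$. -/

import Mathlib

/- With this instance removed, `inner ℂ` is elaborated as the inner product of
`InnerProductSpace` itself (the removed instance gives the same function). -/
attribute [-instance] WithCStarModule.instCStarModuleComplex

/-- The open unit disk `{z : ℂ | |z| < 1}`, as a type. -/
abbrev Disk : Type := Metric.ball (0 : ℂ) 1

/-- A weight: a sequence `(β_k)_{k ≥ 0}` of positive numbers with `liminf β_k ^ (1 / k) ≥ 1`.
The lower limit is taken in `[0, ∞]`, so that unbounded sequences are allowed. -/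
structure Weight where
  seq : ℕ → ℝ
  pos : ∀ k, 0 < seq k
  one_le_liminf : 1 ≤ Filter.liminf
    (fun k : ℕ => ENNReal.ofReal (seq k ^ (1 / (k : ℝ)))) Filter.atTop

/-- `c` is the sequence of Taylor coefficients of `f`: `f z = ∑ c_k z ^ k` on the whole disk. -/
def IsTaylor (c : ℕ → ℂ) (f : Disk → ℂ) : Prop :=
  ∀ z : Disk, HasSum (fun k => c k * (z : ℂ) ^ k) (f z)

theorem IsTaylor.unique {c d : ℕ → ℂ} {f : Disk → ℂ} (hc : IsTaylor c f) (hd : IsTaylor d f) :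
    c = d := by
  classical
  let F : ℂ → ℂ := fun z => if h : z ∈ Metric.ball (0 : ℂ) 1 then f ⟨z, h⟩ else 0
  have key : ∀ e : ℕ → ℂ, IsTaylor e f →
      HasFPowerSeriesAt F (FormalMultilinearSeries.ofScalars ℂ e) 0 := by
    intro e he
    rw [hasFPowerSeriesAt_iff]
    filter_upwards [Metric.ball_mem_nhds (0 : ℂ) one_pos] with z hz
    have h := he ⟨z, hz⟩
    simp only [F, zero_add, dif_pos hz, FormalMultilinearSeries.coeff_ofScalars, smul_eq_mul]
    simpa only [mul_comm] using h
  have h := (key c hc).eq_formalMultilinearSeries (key d hd)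
  funext n
  have hn := congrArg (fun p => FormalMultilinearSeries.coeff p n) h
  simpa only [FormalMultilinearSeries.coeff_ofScalars] using hn

theorem summable_weighted_iff (β : Weight) (c : ℕ → ℂ) :
    Summable (fun k => β.seq k * ‖c k‖ ^ 2) ↔
      Memℓp (fun k => ((√(β.seq k) : ℝ) : ℂ) * c k) 2 := by
  rw [memℓp_gen_iff (by norm_num)]
  refine summable_congr fun k => ?_
  have h := (β.pos k).le
  simp only [norm_mul, Complex.norm_real, Real.norm_eq_abs, abs_of_nonneg (Real.sqrt_nonneg _)]
  norm_num
  rw [mul_pow, Real.sq_sqrt h]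

/-- The functions `f (z) = ∑ c_k z ^ k` on the disk with `∑ β_k |c_k| ^ 2 < ∞`. -/
def H2Submodule (β : Weight) : Submodule ℂ (Disk → ℂ) where
  carrier := {f | ∃ c : ℕ → ℂ, IsTaylor c f ∧ Summable (fun k => β.seq k * ‖c k‖ ^ 2)}
  zero_mem' := ⟨0, fun z => by simp, by simp⟩
  add_mem' := by
    rintro f g ⟨c, hc, hc'⟩ ⟨d, hd, hd'⟩
    refine ⟨c + d, fun z => ?_, ?_⟩
    · simpa [add_mul] using (hc z).add (hd z)
    · rw [summable_weighted_iff] at *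
      convert hc'.add hd' using 2
      simp [mul_add]
  smul_mem' := by
    rintro a f ⟨c, hc, hc'⟩
    refine ⟨a • c, fun z => ?_, ?_⟩
    · simpa [mul_assoc] using (hc z).mul_left a
    · rw [summable_weighted_iff] at *
      convert hc'.const_smul a using 2
      simp [mul_left_comm]

/-- The weighted Hilbert space `H²(β)`.  (A separate type, so that it does not inherit the
topology of pointwise convergence.) -/
def H2 (β : Weight) : Type := ↥(H2Submodule β)

namespace H2

variable {β : Weight}

noncomputable instance : AddCommGroup (H2 β) := inferInstanceAs (AddCommGroup ↥(H2Submodule β))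

noncomputable instance : Module ℂ (H2 β) := inferInstanceAs (Module ℂ ↥(H2Submodule β))

instance : CoeFun (H2 β) (fun _ => Disk → ℂ) := ⟨fun f => f.1⟩

@[ext] theorem ext {f g : H2 β} (h : ∀ z, f z = g z) : f = g := Subtype.ext (funext h)

/-- The Taylor coefficients of an element of `H²(β)`. -/
noncomputable def coeff (f : H2 β) : ℕ → ℂ := f.2.choose

theorem isTaylor (f : H2 β) : IsTaylor f.coeff f := f.2.choose_spec.1

theorem summable (f : H2 β) : Summable (fun k => β.seq k * ‖f.coeff k‖ ^ 2) :=
  f.2.choose_spec.2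

theorem coeff_add (f g : H2 β) : (f + g).coeff = f.coeff + g.coeff := by
  refine (f + g).isTaylor.unique fun z => ?_
  have h := (f.isTaylor z).add (g.isTaylor z)
  simp only [← add_mul] at h
  exact h

theorem coeff_smul (a : ℂ) (f : H2 β) : (a • f).coeff = a • f.coeff := by
  refine (a • f).isTaylor.unique fun z => ?_
  have h := (f.isTaylor z).mul_left a
  simp only [← mul_assoc] at h
  exact h

/-- The linear map `f = ∑ c_k z ^ k ↦ (√β_k c_k)_k` from `H²(β)` to `ℓ²`. -/
noncomputable def toL2 : H2 β →ₗ[ℂ] lp (fun _ : ℕ => ℂ) 2 where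
  toFun f := ⟨fun k => ((√(β.seq k) : ℝ) : ℂ) * f.coeff k,
    (summable_weighted_iff β f.coeff).1 f.summable⟩
  map_add' f g := by
    apply lp.ext
    funext k
    simp only [coeff_add, Pi.add_apply, mul_add]
    rfl
  map_smul' a f := by
    apply lp.ext
    funext k
    simp [coeff_smul, mul_left_comm]

theorem toL2_apply (f : H2 β) (k : ℕ) : toL2 f k = ((√(β.seq k) : ℝ) : ℂ) * f.coeff k := rfl

theorem toL2_injective : Function.Injective (toL2 (β := β)) := by
  intro f g h
  have hc : f.coeff = g.coeff := by
    funext k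
    have hk : toL2 f k = toL2 g k := by rw [h]
    rw [toL2_apply, toL2_apply] at hk
    refine mul_left_cancel₀ ?_ hk
    exact_mod_cast (Real.sqrt_pos.2 (β.pos k)).ne'
  ext z
  have h1 := f.isTaylor z
  rw [hc] at h1
  exact h1.unique (g.isTaylor z)

/-- The norm of `H²(β)`, for which `‖f‖ ^ 2 = ∑ β_k |c_k| ^ 2` (see `H2.norm_sq`). -/
noncomputable instance : NormedAddCommGroup (H2 β) :=
  NormedAddCommGroup.induced (H2 β) (lp (fun _ : ℕ => ℂ) 2) toL2 toL2_injective

noncomputable instance : InnerProductSpace ℂ (H2 β) where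
  norm_smul_le a f := by
    change ‖toL2 (a • f)‖ ≤ ‖a‖ * ‖toL2 f‖
    rw [map_smul, norm_smul]
  inner f g := inner ℂ (toL2 f) (toL2 g)
  norm_sq_eq_re_inner f := InnerProductSpace.norm_sq_eq_re_inner (𝕜 := ℂ) (toL2 f)
  conj_inner_symm f g := InnerProductSpace.conj_inner_symm (𝕜 := ℂ) (toL2 f) (toL2 g)
  add_left f g h := by
    change inner ℂ (toL2 (f + g)) (toL2 h) = inner ℂ (toL2 f) (toL2 h) + inner ℂ (toL2 g) (toL2 h)
    rw [map_add, inner_add_left]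
  smul_left f g a := by
    change inner ℂ (toL2 (a • f)) (toL2 g) = _ * inner ℂ (toL2 f) (toL2 g)
    rw [map_smul, inner_smul_left]

theorem norm_sq (f : H2 β) : ‖f‖ ^ 2 = ∑' k, β.seq k * ‖f.coeff k‖ ^ 2 := by
  change ‖toL2 f‖ ^ 2 = _
  have h := lp.norm_rpow_eq_tsum (p := 2) (by norm_num) (toL2 f)
  norm_num at h
  rw [h]
  refine tsum_congr fun k => ?_
  rw [toL2_apply, norm_mul, mul_pow, Complex.norm_real, Real.norm_eq_abs, sq_abs,
    Real.sq_sqrt (β.pos k).le]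

theorem toL2_surjective : Function.Surjective (toL2 (β := β)) := by
  intro x
  have hsq : ∀ k, ((√(β.seq k) : ℝ) : ℂ) ≠ 0 := fun k => by
    exact_mod_cast (Real.sqrt_pos.2 (β.pos k)).ne'
  let c : ℕ → ℂ := fun k => x k / ((√(β.seq k) : ℝ) : ℂ)
  have hcx : (fun k => ((√(β.seq k) : ℝ) : ℂ) * c k) = x := by
    funext k
    exact mul_div_cancel₀ _ (hsq k)
  have hsum : ∀ z : Disk, Summable (fun k => c k * (z : ℂ) ^ k) := by
    intro z
    have hz : ‖(z : ℂ)‖ < 1 := mem_ball_zero_iff.1 z.2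
    obtain ⟨r, hr, hr1⟩ := exists_between (show ‖(z : ℂ)‖ ^ 2 < 1 by nlinarith [norm_nonneg (z : ℂ)])
    have hr0 : 0 < r := lt_of_le_of_lt (by positivity) hr
    have hq : ‖(z : ℂ)‖ / √r < 1 := by
      rw [div_lt_one (Real.sqrt_pos.2 hr0)]
      exact Real.lt_sqrt_of_sq_lt hr
    refine Summable.of_norm_bounded_eventually_nat
      ((summable_geometric_of_lt_one (by positivity) hq).mul_left ‖x‖) ?_
    have hlim : ENNReal.ofReal r < Filter.liminf
        (fun k : ℕ => ENNReal.ofReal (β.seq k ^ (1 / (k : ℝ)))) Filter.atTop :=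
      lt_of_lt_of_le (by simpa using hr1) β.one_le_liminf
    filter_upwards [Filter.eventually_lt_of_lt_liminf hlim, Filter.eventually_ge_atTop 1]
      with k hk hk1
    have hk0 : (k : ℝ) ≠ 0 := by positivity
    have hrk : r < β.seq k ^ (1 / (k : ℝ)) := (ENNReal.ofReal_lt_ofReal_iff_of_nonneg hr0.le).1 hk
    have hβ : r ^ k ≤ β.seq k := by
      calc r ^ k ≤ (β.seq k ^ (1 / (k : ℝ))) ^ k := by gcongr
        _ = β.seq k := by
          rw [← Real.rpow_natCast, ← Real.rpow_mul (β.pos k).le, one_div, inv_mul_cancel₀ hk0,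
            Real.rpow_one]
    have hsr : √r ^ k ≤ √(β.seq k) := by
      refine Real.le_sqrt_of_sq_le ?_
      rw [← pow_mul, mul_comm, pow_mul, Real.sq_sqrt hr0.le]
      exact hβ
    have hxk : ‖x k‖ ≤ ‖x‖ := lp.norm_apply_le_norm (by norm_num) x k
    have hpos : 0 < √r ^ k := pow_pos (Real.sqrt_pos.2 hr0) k
    simp only [c, norm_mul, norm_div, norm_pow, Complex.norm_real, Real.norm_eq_abs,
      abs_of_nonneg (Real.sqrt_nonneg _)]
    rw [div_pow, mul_div_assoc', div_mul_eq_mul_div]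
    gcongr
  refine ⟨⟨fun z => ∑' k, c k * (z : ℂ) ^ k, c, fun z => (hsum z).hasSum, ?_⟩, ?_⟩
  · rw [summable_weighted_iff, hcx]
    exact lp.memℓp x
  · apply lp.ext
    refine Eq.trans ?_ hcx
    funext k
    refine (toL2_apply _ k).trans (congrArg _ (congrFun ?_ k))
    exact IsTaylor.unique (isTaylor _) fun z => (hsum z).hasSum

/-- `H²(β)` is a Hilbert space. -/
instance : CompleteSpace (H2 β) := by
  have hiso : Isometry (toL2 (β := β)) :=
    AddMonoidHomClass.isometry_of_norm toL2 fun _ => rfl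
  exact (IsometryEquiv.mk (Equiv.ofBijective _ ⟨toL2_injective, toL2_surjective⟩)
    hiso).completeSpace_iff.2 inferInstance

end H2

/-- `T` is the composition operator `C_φ` acting on `H²(β)`, i.e. `C_φ` maps `H²(β)` into itself
and is bounded there, and `T` is this bounded operator. -/
def IsCompositionOperator (φ : Disk → Disk) {β : Weight} (T : H2 β →L[ℂ] H2 β) : Prop :=
  ∀ (f : H2 β) (z : Disk), T f z = f (φ z)

section Operators

variable {H : Type*} [NormedAddCommGroup H] [InnerProductSpace ℂ H]

/-- The `n`-th approximation number (`n ≥ 1`) of a bounded operator: its distance, in operator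
norm, to the operators of rank `< n`. -/
noncomputable def approximationNumber (T : H →L[ℂ] H) (n : ℕ) : ℝ :=
  sInf {r : ℝ | ∃ R : H →L[ℂ] H, R.toLinearMap.rank < n ∧ r = ‖T - R‖}

/-- `(s_n)_{n ≥ 1}` is the sequence of singular numbers of the operator `T`, i.e. `s` is
non-increasing, non-negative, tends to `0`, and there is a Schmidt decomposition
`T x = ∑_{n ≥ 1} s_n ⟨x | v_n⟩ u_n` with orthonormal sequences `(u_n)` and `(v_n)`.
The value `s 0` plays no role. (Mathlib's inner product is conjugate linear on the left.) -/
def IsSingularNumbers (T : H →L[ℂ] H) (s : ℕ → ℝ) : Prop :=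
  AntitoneOn s (Set.Ici 1) ∧ (∀ n ≥ 1, 0 ≤ s n) ∧ Filter.Tendsto s Filter.atTop (nhds 0) ∧
  ∃ u v : ℕ → H, Orthonormal ℂ u ∧ Orthonormal ℂ v ∧
    ∀ x : H, HasSum (fun n : ℕ => ((s (n + 1) : ℝ) : ℂ) • inner ℂ (v n) x • u n) (T x)

/-- The Schatten class `S_p`: compact operators with `∑_{n ≥ 1} a_n(T) ^ p < ∞`. -/
def MemSchatten (p : ℝ) (T : H →L[ℂ] H) : Prop :=
  IsCompactOperator T ∧ Summable (fun n : ℕ => approximationNumber T (n + 1) ^ p)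

end Operators

/-- Log-subordination of the sequence `(u_n)_{n ≥ 1}` to the sequence `(v_n)_{n ≥ 1}`. -/
def LogSubordinate (u v : ℕ → ℝ) : Prop :=
  ∀ n ≥ 1, ∏ j ∈ Finset.Icc 1 n, u j ≤ ∏ j ∈ Finset.Icc 1 n, v j

/-! In the bases of normalized monomials, `C_φ` on `H²(β)` has the matrix `√β_j / √β_k * m j k`,
where `m j k` is the `j`-th Taylor coefficient of `φ ^ k`. It is lower triangular because `φ 0 = 0`.
Passing to `γ` conjugates it to `D⁻¹ A D`, with `D` diagonal and entries `√(β_k / γ_k)`,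
non-decreasing in `k`. On finite sections, `D ^ (-z) A D ^ z` is bounded for `0 ≤ re z` by
triangularity and monotonicity, and for imaginary `z` it is unitarily equivalent to `A`.
Phragmén–Lindelöf, applied to a determinant formed from this family, carries the bounds valid for
`A` to `z = 1` (`norm_det_formMatrix_scaled_le`, `GramDetBound.of_scaled`).

These determinants control approximation numbers: `a_1 ⋯ a_n` is the least nonnegative `K` with
`GramDetBound T n K`, for every bounded `T`. That it is such a bound follows from Hadamard's
inequality in a basis adapted to near-optimal finite-rank approximants
(`gramDetBound_prod_norm_sub`). That it is the least follows by induction from a Schur complement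
(`approximationNumber_mul_norm_det_le`). Neither half uses compactness or a spectral decomposition.

Log-subordination of the approximation numbers follows at once. It yields the inequality for index
`2n`, hence compactness, and Weyl's majorization argument gives the Schatten classes. Singular
numbers are handled by identifying them with approximation numbers. -/

theorem prod_Icc_one_eq_prod_range (f : ℕ → ℝ) (n : ℕ) :
    ∏ j ∈ Finset.Icc 1 n, f j = ∏ j ∈ Finset.range n, f (j + 1) := by
  induction n with
  | zero => simp
  | succ n ih => rw [Finset.prod_Icc_succ_top (by omega), ih, Finset.prod_range_succ]

/-! ### Mixed Gram determinants and Hadamard's inequality -/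

section GramDeterminants

variable {H : Type*} [NormedAddCommGroup H] [InnerProductSpace ℂ H]

/-- **Hadamard's inequality** for the coordinate matrix in an orthonormal basis. -/
theorem OrthonormalBasis.norm_det_le {n : ℕ} (b : OrthonormalBasis (Fin n) ℂ H) (v : Fin n → H) :
    ‖b.toBasis.det v‖ ≤ ∏ i, ‖v i‖ := by
  have : FiniteDimensional ℂ H := b.toBasis.finiteDimensional_of_finite
  have hfin : Module.finrank ℂ H = Fintype.card (Fin n) := Module.finrank_eq_card_basis b.toBasis
  set g := InnerProductSpace.gramSchmidtOrthonormalBasis hfin v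
  have h1 : b.toBasis.det v = b.toBasis.det g * g.toBasis.det v := by
    rw [Module.Basis.det_apply, Module.Basis.det_apply, Module.Basis.det_apply, ← Matrix.det_mul,
      ← g.coe_toBasis, Module.Basis.toMatrix_mul_toMatrix]
  rw [h1, norm_mul, OrthonormalBasis.det_to_matrix_orthonormalBasis, one_mul,
    InnerProductSpace.gramSchmidtOrthonormalBasis_det, norm_prod]
  refine Finset.prod_le_prod (fun _ _ => norm_nonneg _) fun i _ => ?_
  refine (norm_inner_le_norm _ _).trans ?_
  rw [OrthonormalBasis.norm_eq_one, one_mul]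

/-- Projecting `w` orthogonally onto the span of `y` changes no entry and increases no norm. Inside
the span the matrix is a product of two coordinate matrices in an orthonormal basis, and Hadamard's
inequality applies to each factor. -/
theorem norm_det_inner_le {n : ℕ} (y w : Fin n → H) :
    ‖(Matrix.of fun l i => inner ℂ (y l) (w i)).det‖ ≤ (∏ i, ‖w i‖) * ∏ i, ‖y i‖ := by
  by_cases hy : LinearIndependent ℂ y
  · set W := Submodule.span ℂ (Set.range y)
    have : FiniteDimensional ℂ W := FiniteDimensional.span_of_finite ℂ (Set.finite_range y)
    have hfin : Module.finrank ℂ W = n := by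
      simpa using finrank_span_eq_card hy
    let f : OrthonormalBasis (Fin n) ℂ W := (stdOrthonormalBasis ℂ W).reindex (finCongr hfin)
    let y' : Fin n → W := fun l => ⟨y l, Submodule.subset_span ⟨l, rfl⟩⟩
    let w' : Fin n → W := fun i => W.orthogonalProjectionOnto (w i)
    have hM : (Matrix.of fun l i => inner ℂ (y l) (w i)) =
        (f.toBasis.toMatrix y').conjTranspose * f.toBasis.toMatrix w' := by
      ext l i
      have h1 : inner ℂ (y l) (w i) = inner ℂ (y' l) (w' i) := by
        rw [Submodule.inner_orthogonalProjectionOnto_eq_of_mem_left]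
      rw [Matrix.of_apply, h1, ← f.sum_inner_mul_inner]
      simp [Matrix.mul_apply, Module.Basis.toMatrix_apply, OrthonormalBasis.repr_apply_apply]
    rw [hM, Matrix.det_mul, Matrix.det_conjTranspose, norm_mul, norm_star, mul_comm]
    refine mul_le_mul ?_ (f.norm_det_le y') (norm_nonneg _)
      (Finset.prod_nonneg fun _ _ => norm_nonneg _)
    refine (f.norm_det_le w').trans (Finset.prod_le_prod (fun _ _ => norm_nonneg _) fun i _ => ?_)
    exact Submodule.norm_orthogonalProjectionOnto_apply_le _ _
  · obtain ⟨c, hc, i, hi⟩ := Fintype.not_linearIndependent_iff.1 hy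
    have h0 : (Matrix.of fun l i => inner ℂ (y l) (w i)).det = 0 := by
      -- The coefficients are conjugated because the inner product is conjugate linear in its first
      -- argument.
      refine Matrix.exists_vecMul_eq_zero_iff.1 ⟨fun i => star (c i), ?_, ?_⟩
      · intro h
        exact hi (by simpa using congrFun h i)
      · ext k
        have : inner ℂ (∑ i, c i • y i) (w k) = 0 := by rw [hc, inner_zero_left]
        simpa [Matrix.vecMul, dotProduct, sum_inner, inner_smul_left] using this
    rw [h0, norm_zero]
    positivity

/-- Greedy choice: `L m` has dimension greater than `m`, so it contains a unit vector orthogonal to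
the `m` vectors already chosen. The subspaces need not be nested. -/
theorem exists_orthonormal_mem (L : ℕ → Submodule ℂ H) (m : ℕ)
    (hL : ∀ i < m, i < Module.finrank ℂ (L i)) :
    ∃ f : Fin m → H, Orthonormal ℂ f ∧ ∀ i : Fin m, f i ∈ L i := by
  induction m with
  | zero => exact ⟨Fin.elim0, ⟨fun i => i.elim0, fun i => i.elim0⟩, fun i => i.elim0⟩
  | succ m ih =>
    obtain ⟨f, hf, hfL⟩ := ih fun i hi => hL i (by omega)
    have hm := hL m (by omega)
    have : FiniteDimensional ℂ (L m) := Module.finite_of_finrank_pos (by omega)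
    let Φ : L m →ₗ[ℂ] (Fin m → ℂ) :=
      LinearMap.pi fun i => (innerSL ℂ (f i)).toLinearMap ∘ₗ (L m).subtype
    have hker : LinearMap.ker Φ ≠ ⊥ := LinearMap.ker_ne_bot_of_finrank_lt (by simpa using hm)
    obtain ⟨w, hw, hw0⟩ := (Submodule.ne_bot_iff _).1 hker
    have hw0' : (w : H) ≠ 0 := fun h => hw0 (Subtype.ext h)
    have horth : ∀ i, inner ℂ (f i) (w : H) = 0 := fun i => congrFun (LinearMap.mem_ker.1 hw) i
    let e : H := ((‖(w : H)‖ : ℂ)⁻¹) • (w : H)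
    have he : ‖e‖ = 1 := by
      simp [e, norm_smul, hw0']
    have heo : ∀ i, inner ℂ (f i) e = 0 := fun i => by simp [e, inner_smul_right, horth i]
    refine ⟨Fin.snoc f e, ⟨fun i => ?_, fun i j hij => ?_⟩, fun i => ?_⟩
    · refine Fin.lastCases ?_ (fun i => ?_) i
      · simpa using he
      · simpa using hf.1 i
    · revert hij
      refine Fin.lastCases ?_ (fun i => ?_) i <;> refine Fin.lastCases ?_ (fun j => ?_) j
      · intro h; exact absurd rfl h
      · intro _
        simpa using inner_eq_zero_symm.1 (heo j)
      · intro _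
        simpa using heo i
      · intro h
        simpa using hf.2 fun h' => h (by rw [h'])
    · refine Fin.lastCases ?_ (fun i => ?_) i
      · simpa [e] using (L m).smul_mem _ w.2
      · simpa using hfL i

/-- `K` bounds the norm of the `n`-th exterior power of `T`, expressed through the mixed Gram
determinants `det ⟨y_l, T x_i⟩`. -/
def GramDetBound (T : H →L[ℂ] H) (n : ℕ) (K : ℝ) : Prop :=
  ∀ x y : Fin n → H, ‖(Matrix.of fun l i => inner ℂ (y l) (T (x i))).det‖ ≤
    K * ((∏ i, ‖x i‖) * ∏ i, ‖y i‖)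

/-- The span of `x` has an orthonormal basis `b` with `R i (b i) = 0`, so that `‖T (b i)‖ ≤ ‖T - R
i‖`. Expanding `x` in `b` factors the matrix, and Hadamard's inequality bounds both factors. -/
theorem gramDetBound_prod_norm_sub (T : H →L[ℂ] H) (n : ℕ) (R : ℕ → H →L[ℂ] H)
    (hR : ∀ i < n, (R i).toLinearMap.rank < (i + 1 : ℕ)) :
    GramDetBound T n (∏ i ∈ Finset.range n, ‖T - R i‖) := by
  intro x y
  by_cases hx : LinearIndependent ℂ x
  · set V := Submodule.span ℂ (Set.range x)
    have : FiniteDimensional ℂ V := FiniteDimensional.span_of_finite ℂ (Set.finite_range x)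
    have hfin : Module.finrank ℂ V = n := by simpa using finrank_span_eq_card hx
    -- `R (n - 1 - i)` has rank at most `n - 1 - i`, so its kernel in `V` has dimension at least `i
    -- + 1`. The order is reversed so that the smallest kernel is used first; `Fin.rev` undoes this
    -- below.
    obtain ⟨f, hf, hfL⟩ := exists_orthonormal_mem
      (fun i => LinearMap.ker ((R (n - 1 - i)).toLinearMap ∘ₗ V.subtype)) n (by
        intro i hi
        have h1 := LinearMap.finrank_range_add_finrank_ker
          ((R (n - 1 - i)).toLinearMap ∘ₗ V.subtype)
        have h2 : ((R (n - 1 - i)).toLinearMap ∘ₗ V.subtype).rank < (n - 1 - i + 1 : ℕ) :=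
          (LinearMap.rank_comp_le_left _ _).trans_lt (hR _ (by omega))
        have h3 : Module.finrank ℂ
            (LinearMap.range ((R (n - 1 - i)).toLinearMap ∘ₗ V.subtype)) < n - 1 - i + 1 := by
          rw [LinearMap.rank, ← Module.finrank_eq_rank] at h2
          exact_mod_cast h2
        omega)
    obtain ⟨b, hb⟩ := Orthonormal.exists_orthonormalBasis_extension_of_card_eq
      (𝕜 := ℂ) (E := V) (ι := Fin n) (by simp [hfin]) (v := f ∘ Fin.rev) (s := Set.univ)
      (by
        have := (hf.comp Fin.rev Fin.rev_injective).comp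
          (Subtype.val : ↥(Set.univ : Set (Fin n)) → Fin n) Subtype.val_injective
        exact this)
    have hbR : ∀ i : Fin n, R i (b i : H) = 0 := by
      intro i
      have h := hfL (Fin.rev i)
      have h2 : n - 1 - (n - (i + 1 : ℕ)) = (i : ℕ) := by omega
      simp only [LinearMap.mem_ker, LinearMap.comp_apply, Fin.val_rev, h2] at h
      rw [hb i (Set.mem_univ _)]
      exact h
    let x' : Fin n → V := fun l => ⟨x l, Submodule.subset_span ⟨l, rfl⟩⟩
    have hM : (Matrix.of fun l i => inner ℂ (y l) (T (x i))) =
        (Matrix.of fun l i => inner ℂ (y l) (T (b i : H))) * b.toBasis.toMatrix x' := by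
      ext l i
      have h1 : x i = ∑ k, b.repr (x' i) k • (b k : H) := by
        have := congrArg (Subtype.val) (b.sum_repr (x' i))
        simpa using this.symm
      rw [Matrix.of_apply]
      conv_lhs => rw [h1]
      simp only [map_sum, map_smul, inner_sum, inner_smul_right, Matrix.mul_apply, Matrix.of_apply,
        Module.Basis.toMatrix_apply]
      exact Finset.sum_congr rfl fun k _ => mul_comm _ _
    rw [hM, Matrix.det_mul, norm_mul]
    have h1 := norm_det_inner_le y (fun i => T (b i : H))
    have h2 : ‖(b.toBasis.toMatrix x').det‖ ≤ ∏ i, ‖x i‖ := b.norm_det_le x'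
    have h3 : ∏ i, ‖T (b i : H)‖ ≤ ∏ i ∈ Finset.range n, ‖T - R i‖ := by
      rw [Finset.prod_range]
      refine Finset.prod_le_prod (fun _ _ => norm_nonneg _) fun i _ => ?_
      have : T (b i : H) = (T - R i) (b i : H) := by simp [hbR]
      rw [this]
      refine ((T - R i).le_opNorm _).trans_eq ?_
      rw [← Submodule.coe_norm, b.norm_eq_one, mul_one]
    calc _ ≤ ((∏ i ∈ Finset.range n, ‖T - R i‖) * ∏ i, ‖y i‖) * ∏ i, ‖x i‖ := by
          gcongr
          exact h1.trans (by gcongr)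
      _ = _ := by ring
  · obtain ⟨c, hc, i, hi⟩ := Fintype.not_linearIndependent_iff.1 hx
    have h0 : (Matrix.of fun l i => inner ℂ (y l) (T (x i))).det = 0 := by
      refine Matrix.exists_mulVec_eq_zero_iff.1 ⟨c, ?_, ?_⟩
      · intro h
        exact hi (by simpa using congrFun h i)
      · ext k
        have : inner ℂ (y k) (T (∑ i, c i • x i)) = 0 := by rw [hc, map_zero, inner_zero_right]
        simpa [Matrix.mulVec, dotProduct, inner_sum, inner_smul_right, mul_comm] using this
    rw [h0, norm_zero]
    positivity

end GramDeterminants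

/-! ### Approximation numbers and the upper bound for Gram determinants -/

section ApproximationNumbers

variable {H : Type*} [NormedAddCommGroup H] [InnerProductSpace ℂ H]

theorem approximationNumber_le (T R : H →L[ℂ] H) {n : ℕ} (hR : R.toLinearMap.rank < n) :
    approximationNumber T n ≤ ‖T - R‖ :=
  csInf_le ⟨0, by rintro _ ⟨R, -, rfl⟩; exact norm_nonneg _⟩ ⟨R, hR, rfl⟩

theorem approximationNumber_nonneg (T : H →L[ℂ] H) (n : ℕ) : 0 ≤ approximationNumber T n :=
  Real.sInf_nonneg (by rintro _ ⟨R, -, rfl⟩; exact norm_nonneg _)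

theorem rank_zero_lt {n : ℕ} (hn : 1 ≤ n) : (0 : H →L[ℂ] H).toLinearMap.rank < n := by
  have : (0 : H →L[ℂ] H).toLinearMap.rank = 0 := LinearMap.rank_zero
  rw [this]
  exact_mod_cast hn

theorem approximationNumber_set_nonempty (T : H →L[ℂ] H) {n : ℕ} (hn : 1 ≤ n) :
    {r : ℝ | ∃ R : H →L[ℂ] H, R.toLinearMap.rank < n ∧ r = ‖T - R‖}.Nonempty :=
  ⟨_, 0, rank_zero_lt hn, rfl⟩

theorem exists_norm_sub_lt (T : H →L[ℂ] H) {n : ℕ} (hn : 1 ≤ n) {r : ℝ}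
    (hr : approximationNumber T n < r) :
    ∃ R : H →L[ℂ] H, R.toLinearMap.rank < n ∧ ‖T - R‖ < r := by
  obtain ⟨_, ⟨R, hR, rfl⟩, h⟩ := exists_lt_of_csInf_lt (approximationNumber_set_nonempty T hn) hr
  exact ⟨R, hR, h⟩

theorem le_approximationNumber (T : H →L[ℂ] H) {n : ℕ} (hn : 1 ≤ n) {r : ℝ}
    (h : ∀ R : H →L[ℂ] H, R.toLinearMap.rank < n → r ≤ ‖T - R‖) :
    r ≤ approximationNumber T n :=
  le_csInf (approximationNumber_set_nonempty T hn) (by rintro _ ⟨R, hR, rfl⟩; exact h R hR)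

theorem approximationNumber_anti (T : H →L[ℂ] H) {m n : ℕ} (hm : 1 ≤ m) (hmn : m ≤ n) :
    approximationNumber T n ≤ approximationNumber T m :=
  le_approximationNumber T hm fun R hR =>
    approximationNumber_le T R (hR.trans_le (by exact_mod_cast hmn))

theorem approximationNumber_one (T : H →L[ℂ] H) : approximationNumber T 1 = ‖T‖ := by
  refine le_antisymm ?_ (le_approximationNumber T le_rfl fun R hR => ?_)
  · simpa using approximationNumber_le T 0 (rank_zero_lt le_rfl)
  · have h1 : R.toLinearMap.rank = 0 := by
      have : R.toLinearMap.rank < 1 := by simpa using hR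
      exact Cardinal.lt_one_iff.1 this
    have h2 : R = 0 := by
      ext x
      have h3 : LinearMap.range R.toLinearMap = ⊥ := Submodule.rank_eq_zero.1 h1
      exact LinearMap.congr_fun (LinearMap.range_eq_bot.1 h3) x
    simp [h2]

theorem gramDetBound_prod_approximationNumber (T : H →L[ℂ] H) (n : ℕ) :
    GramDetBound T n (∏ j ∈ Finset.Icc 1 n, approximationNumber T j) := by
  intro x y
  set C := (∏ i, ‖x i‖) * ∏ i, ‖y i‖
  have hC : 0 ≤ C := by positivity
  -- The infima defining the approximation numbers need not be attained, hence a slack `ε` in each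
  -- factor, removed by letting `ε` tend to `0`.
  have key : ∀ ε > 0, ‖(Matrix.of fun l i => inner ℂ (y l) (T (x i))).det‖ ≤
      (∏ j ∈ Finset.range n, (approximationNumber T (j + 1) + ε)) * C := by
    intro ε hε
    choose R hR hRn using fun j : ℕ => exists_norm_sub_lt T (n := j + 1) (by omega)
      (lt_add_of_pos_right _ hε)
    refine (gramDetBound_prod_norm_sub T n R (fun i _ => hR i) x y).trans ?_
    refine mul_le_mul_of_nonneg_right ?_ hC
    exact Finset.prod_le_prod (fun _ _ => norm_nonneg _) fun i _ => (hRn i).le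
  have hlim : Filter.Tendsto
      (fun ε : ℝ => (∏ j ∈ Finset.range n, (approximationNumber T (j + 1) + ε)) * C)
      (nhdsWithin 0 (Set.Ioi 0))
      (nhds ((∏ j ∈ Finset.range n, (approximationNumber T (j + 1) + 0)) * C)) := by
    refine Filter.Tendsto.mono_left ?_ nhdsWithin_le_nhds
    exact Continuous.tendsto (by fun_prop) 0
  have := ge_of_tendsto hlim (by filter_upwards [self_mem_nhdsWithin] with ε hε using key ε hε)
  simpa [prod_Icc_one_eq_prod_range] using this

end ApproximationNumbers

/-! ### Cross approximation and the converse bound -/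

section CrossApproximation

variable {H : Type*} [NormedAddCommGroup H] [InnerProductSpace ℂ H]

theorem norm_le_of_inner_le (S : H →L[ℂ] H) {C : ℝ} (hC : 0 ≤ C)
    (h : ∀ u v, ‖inner ℂ v (S u)‖ ≤ C * (‖u‖ * ‖v‖)) : ‖S‖ ≤ C := by
  refine S.opNorm_le_bound hC fun u => ?_
  have h1 := h u (S u)
  rw [inner_self_eq_norm_sq_to_K] at h1
  rcases (norm_nonneg (S u)).eq_or_lt with h0 | h0
  · rw [← h0]; positivity
  · refine le_of_mul_le_mul_right ?_ h0
    calc ‖S u‖ * ‖S u‖ = ‖((‖S u‖ : ℝ) : ℂ) ^ 2‖ := by simp [sq]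
      _ ≤ _ := h1.trans_eq (by ring)

theorem rank_le_of_range_le_span {n : ℕ} (R : H →L[ℂ] H) (w : Fin n → H)
    (h : ∀ u, R u ∈ Submodule.span ℂ (Set.range w)) : R.toLinearMap.rank ≤ n := by
  have h1 : LinearMap.range R.toLinearMap ≤ Submodule.span ℂ (Set.range w) := by
    rintro _ ⟨u, rfl⟩
    exact h u
  have : FiniteDimensional ℂ (Submodule.span ℂ (Set.range w)) :=
    FiniteDimensional.span_of_finite ℂ (Set.finite_range w)
  refine (Submodule.rank_mono h1).trans ?_
  rw [← Module.finrank_eq_rank]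
  exact_mod_cast (finrank_range_le_card w).trans_eq (Fintype.card_fin n)

/-- Cross approximation: `T` differs from an operator of rank at most `n` by an operator whose
matrix coefficients are quotients of mixed Gram determinants of orders `n + 1` and `n`. -/
theorem approximationNumber_mul_norm_det_le (T : H →L[ℂ] H) {n : ℕ} {K : ℝ} (hK0 : 0 ≤ K)
    (hK : GramDetBound T (n + 1) K) (x y : Fin n → H) :
    approximationNumber T (n + 1) * ‖(Matrix.of fun l i => inner ℂ (y l) (T (x i))).det‖ ≤
      K * ((∏ i, ‖x i‖) * ∏ i, ‖y i‖) := by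
  set M : Matrix (Fin n) (Fin n) ℂ := Matrix.of fun l i => inner ℂ (y l) (T (x i)) with hMdef
  set P := (∏ i, ‖x i‖) * ∏ i, ‖y i‖ with hP
  have hP0 : 0 ≤ P := by positivity
  by_cases hM : M.det = 0
  · rw [hM, norm_zero, mul_zero]; positivity
  -- `R` interpolates `T`: it agrees with `T` on every `x i`, and `R u` and `T u` have the same
  -- inner products with every `y l`.
  let R : H →L[ℂ] H := ∑ i, ∑ l, M⁻¹ i l • ((innerSL ℂ (y l)).comp T).smulRight (T (x i))
  have hRu : ∀ u, R u = ∑ i, ∑ l, (M⁻¹ i l * inner ℂ (y l) (T u)) • T (x i) := by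
    intro u
    simp [R, mul_smul]
  have hrank : R.toLinearMap.rank < (n + 1 : ℕ) := by
    refine (rank_le_of_range_le_span R (fun i => T (x i)) fun u => ?_).trans_lt
      (by exact_mod_cast Nat.lt_succ_self n)
    rw [hRu]
    exact Submodule.sum_mem _ fun i _ => Submodule.sum_mem _ fun l _ =>
      Submodule.smul_mem _ _ (Submodule.subset_span ⟨i, rfl⟩)
  have hinv : Invertible M := M.invertibleOfIsUnitDet (isUnit_iff_ne_zero.2 hM)
  have hMpos : 0 < ‖M.det‖ := norm_pos_iff.2 hM
  have hS : ‖T - R‖ ≤ K * P / ‖M.det‖ := by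
    refine norm_le_of_inner_le _ (by positivity) fun u v => ?_
    -- Bordering `M` by `u` and `v` gives a matrix whose Schur complement with respect to `M` is the
    -- scalar `⟨v, (T - R) u⟩`. Its determinant is therefore `det M` times this scalar.
    have h1 := hK (Fin.append x ![u]) (Fin.append y ![v])
    let B : Matrix (Fin n) (Fin 1) ℂ := Matrix.of fun l _ => inner ℂ (y l) (T u)
    let C : Matrix (Fin 1) (Fin n) ℂ := Matrix.of fun _ i => inner ℂ v (T (x i))
    let D : Matrix (Fin 1) (Fin 1) ℂ := Matrix.of fun _ _ => inner ℂ v (T u)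
    have h2 : (Matrix.of fun l i => inner ℂ (Fin.append y ![v] l)
        (T (Fin.append x ![u] i))).submatrix finSumFinEquiv finSumFinEquiv =
        Matrix.fromBlocks M B C D := by
      ext l i
      rcases l with l | l <;> rcases i with i | i <;> simp [M, B, C, D]
    rw [← Matrix.det_submatrix_equiv_self finSumFinEquiv, h2, Matrix.det_fromBlocks₁₁,
      norm_mul, Matrix.det_fin_one] at h1
    have h3 : (D - C * ⅟M * B) 0 0 = inner ℂ v ((T - R) u) := by
      rw [sub_apply, hRu, inner_sub_right, Matrix.sub_apply,
        Matrix.invOf_eq_nonsing_inv, Matrix.mul_assoc, Matrix.mul_apply]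
      congr 1
      simp only [Matrix.mul_apply, inner_sum, inner_smul_right, Finset.mul_sum, B, C,
        Matrix.of_apply]
      exact Finset.sum_congr rfl fun i _ => Finset.sum_congr rfl fun l _ => by ring
    rw [h3, Fin.prod_univ_add, Fin.prod_univ_add] at h1
    simp only [Fin.append_left, Fin.append_right, Fin.prod_univ_one, Matrix.cons_val_zero] at h1
    rw [div_mul_eq_mul_div, le_div_iff₀ hMpos, mul_comm]
    exact h1.trans_eq (by rw [hP]; ring)
  exact (le_div_iff₀ hMpos).1 ((approximationNumber_le T R hrank).trans hS)

/-- By cross approximation, a bound `K` at order `n + 1` gives the bound `K / a_{n+1}` at order `n`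
when `a_{n+1}` is nonzero, so the factors split off one at a time. -/
theorem prod_approximationNumber_le (T : H →L[ℂ] H) (n : ℕ) :
    ∀ K : ℝ, 0 ≤ K → GramDetBound T n K →
      ∏ j ∈ Finset.Icc 1 n, approximationNumber T j ≤ K := by
  induction n with
  | zero =>
    intro K _ hK
    simpa using hK Fin.elim0 Fin.elim0
  | succ n ih =>
    intro K hK0 hK
    rw [Finset.prod_Icc_succ_top (by omega)]
    rcases (approximationNumber_nonneg T (n + 1)).eq_or_lt with h0 | h0
    · rw [← h0, mul_zero]; exact hK0
    · rw [← le_div_iff₀ h0]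
      refine ih _ (by positivity) fun x y => ?_
      rw [div_mul_eq_mul_div, le_div_iff₀ h0, mul_comm]
      exact approximationNumber_mul_norm_det_le T hK0 hK x y

end CrossApproximation

/-! ### Singular numbers are approximation numbers -/

section SingularNumbers

variable {H : Type*} [NormedAddCommGroup H] [InnerProductSpace ℂ H]

theorem Orthonormal.norm_sum_smul_sq {ι : Type*} {u : ι → H} (hu : Orthonormal ℂ u)
    (c : ι → ℂ) (s : Finset ι) : ‖∑ i ∈ s, c i • u i‖ ^ 2 = ∑ i ∈ s, ‖c i‖ ^ 2 := by
  have h := hu.inner_sum c c s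
  rw [inner_self_eq_norm_sq_to_K] at h
  have h2 : ((‖∑ i ∈ s, c i • u i‖ ^ 2 : ℝ) : ℂ) = ((∑ i ∈ s, ‖c i‖ ^ 2 : ℝ) : ℂ) := by
    push_cast
    refine h.trans (Finset.sum_congr rfl fun i _ => ?_)
    simpa using Complex.conj_mul' (c i)
  exact_mod_cast h2

/-- An operator of rank at most `m` kills a nonzero combination of `v 0, …, v m`, on which `T`
multiplies norms by at least `s (m + 1)`. Conversely, cutting the Schmidt series after `m` terms
leaves an error of norm at most `s (m + 1)`. The vectors are numbered from `0`, the singular numbers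
from `1`. -/
theorem IsSingularNumbers.eq_approximationNumber {T : H →L[ℂ] H} {s : ℕ → ℝ}
    (hs : IsSingularNumbers T s) {n : ℕ} (hn : 1 ≤ n) : s n = approximationNumber T n := by
  obtain ⟨hanti, hnonneg, -, u, v, hu, hv, hT⟩ := hs
  obtain ⟨m, rfl⟩ : ∃ m, n = m + 1 := ⟨n - 1, by omega⟩
  apply le_antisymm
  · refine le_approximationNumber T hn fun R hR => ?_
    let Φ : (Fin (m + 1) → ℂ) →ₗ[ℂ] H :=
      R.toLinearMap ∘ₗ Fintype.linearCombination ℂ (fun i : Fin (m + 1) => v i)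
    have hker : LinearMap.ker Φ ≠ ⊥ := by
      intro h
      have h1 : Φ.rank < (m + 1 : ℕ) := (LinearMap.rank_comp_le_left _ _).trans_lt hR
      have h2 := LinearMap.finrank_range_add_finrank_ker Φ
      rw [h, finrank_bot, add_zero, Module.finrank_fin_fun] at h2
      rw [LinearMap.rank, ← Module.finrank_eq_rank, h2] at h1
      exact lt_irrefl _ h1
    obtain ⟨c, hc, hc0⟩ := (Submodule.ne_bot_iff _).1 hker
    set x : H := ∑ i : Fin (m + 1), c i • v i with hx
    have hRx : R x = 0 := by
      simpa [Φ, Fintype.linearCombination_apply, hx] using hc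
    have hTv : ∀ k, T (v k) = ((s (k + 1) : ℝ) : ℂ) • u k := by
      intro k
      refine (hT (v k)).unique ?_
      have := hasSum_single (f := fun n : ℕ =>
        ((s (n + 1) : ℝ) : ℂ) • inner ℂ (v n) (v k) • u n) k (fun j hj => by
          simp [hv.2 hj])
      simpa [inner_self_eq_norm_sq_to_K, hv.1 k] using this
    have hTx : T x = ∑ i : Fin (m + 1), (c i * ((s (i + 1) : ℝ) : ℂ)) • u i := by
      simp [hx, map_sum, hTv, mul_smul]
    have hx2 : ‖x‖ ^ 2 = ∑ i, ‖c i‖ ^ 2 :=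
      (hv.comp (fun i : Fin (m + 1) => (i : ℕ)) Fin.val_injective).norm_sum_smul_sq c Finset.univ
    have hTx2 : ‖T x‖ ^ 2 = ∑ i : Fin (m + 1), ‖c i * ((s (i + 1) : ℝ) : ℂ)‖ ^ 2 := by
      rw [hTx]
      exact (hu.comp (fun i : Fin (m + 1) => (i : ℕ)) Fin.val_injective).norm_sum_smul_sq
        _ Finset.univ
    have hxpos : 0 < ‖x‖ := by
      have : ‖x‖ ^ 2 ≠ 0 := by
        rw [hx2]
        intro h
        refine hc0 (funext fun i => ?_)
        have := (Finset.sum_eq_zero_iff_of_nonneg (fun i _ => sq_nonneg ‖c i‖)).1 h i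
          (Finset.mem_univ i)
        simpa using this
      exact lt_of_le_of_ne (norm_nonneg x) fun h => this (by rw [← h]; simp)
    have hle : s (m + 1) * ‖x‖ ≤ ‖T x‖ := by
      refine le_of_sq_le_sq ?_ (norm_nonneg _)
      rw [mul_pow, hx2, hTx2, Finset.mul_sum]
      refine Finset.sum_le_sum fun i _ => ?_
      rw [norm_mul, mul_pow, mul_comm, Complex.norm_real, Real.norm_eq_abs, sq_abs]
      have h1 := hanti (show (i : ℕ) + 1 ∈ Set.Ici 1 by simp) (show m + 1 ∈ Set.Ici 1 by simp)
        (by omega)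
      have h2 := hnonneg (m + 1) (by omega)
      gcongr
    refine le_of_mul_le_mul_right (hle.trans ?_) hxpos
    have : T x = (T - R) x := by simp [hRx]
    rw [this]
    exact (T - R).le_opNorm x
  · let R : H →L[ℂ] H :=
      ∑ k : Fin m, ((s (k + 1) : ℝ) : ℂ) • (innerSL ℂ (v k)).smulRight (u k)
    have hRx : ∀ x, R x = ∑ k ∈ Finset.range m, ((s (k + 1) : ℝ) : ℂ) • inner ℂ (v k) x • u k := by
      intro x
      simp [R, Finset.sum_range]
    have hrank : R.toLinearMap.rank < (m + 1 : ℕ) := by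
      refine (rank_le_of_range_le_span R (fun k : Fin m => u k) fun x => ?_).trans_lt
        (by exact_mod_cast Nat.lt_succ_self m)
      rw [hRx, Finset.sum_range]
      exact Submodule.sum_mem _ fun i _ => Submodule.smul_mem _ _
        (Submodule.smul_mem _ _ (Submodule.subset_span ⟨i, rfl⟩))
    refine (approximationNumber_le T R hrank).trans ?_
    have hs0 := hnonneg (m + 1) (by omega)
    refine (T - R).opNorm_le_bound hs0 fun x => ?_
    have hsum := ((hasSum_nat_add_iff' m).2 (hT x)).tendsto_sum_nat
    rw [← hRx] at hsum
    refine le_of_tendsto hsum.norm (Filter.Eventually.of_forall fun N => ?_)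
    refine le_of_sq_le_sq ?_ (by positivity)
    have h1 := (hu.comp (fun i : ℕ => i + m) (add_left_injective m)).norm_sum_smul_sq
      (fun i => ((s (i + m + 1) : ℝ) : ℂ) * inner ℂ (v (i + m)) x) (Finset.range N)
    simp only [Function.comp_apply, mul_smul] at h1
    rw [h1, mul_pow]
    have h2 := (hv.comp (fun i : ℕ => i + m) (add_left_injective m)).sum_inner_products_le
      (s := Finset.range N) x
    refine le_trans ?_ (mul_le_mul_of_nonneg_left h2 (sq_nonneg _))
    rw [Finset.mul_sum]
    refine Finset.sum_le_sum fun i _ => ?_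
    rw [norm_mul, mul_pow, Complex.norm_real, Real.norm_eq_abs, sq_abs]
    have h1 := hanti (show m + 1 ∈ Set.Ici 1 by simp) (show i + m + 1 ∈ Set.Ici 1 by simp)
      (by omega)
    have h2 := hnonneg (i + m + 1) (by omega)
    simp only [Function.comp_apply]
    gcongr

end SingularNumbers

/-! ### Compactness and decay of approximation numbers -/

section Compactness

variable {H : Type*} [NormedAddCommGroup H] [InnerProductSpace ℂ H]

theorem tendsto_approximationNumber_of_isCompactOperator {T : H →L[ℂ] H}
    (hT : IsCompactOperator T) :
    Filter.Tendsto (approximationNumber T) Filter.atTop (nhds 0) := by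
  rw [Metric.tendsto_atTop]
  intro ε hε
  have htb : TotallyBounded (T '' Metric.closedBall 0 1) :=
    (hT.isCompact_closure_image_closedBall 1).totallyBounded.subset subset_closure
  obtain ⟨t, ht, hcov⟩ := Metric.totallyBounded_iff.1 htb (ε / 2) (half_pos hε)
  let V := Submodule.span ℂ t
  have : FiniteDimensional ℂ V := FiniteDimensional.span_of_finite ℂ ht
  -- `V` is spanned by a finite `ε / 2`-net of the image of the unit ball, so projecting onto it
  -- moves no point of that image by more than `ε / 2`.
  let R : H →L[ℂ] H := V.starProjection ∘L T
  have hrank : R.toLinearMap.rank < (Module.finrank ℂ V + 1 : ℕ) := by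
    have h1 : LinearMap.range R.toLinearMap ≤ V := by
      rintro _ ⟨u, rfl⟩
      exact V.starProjection_apply_mem (T u)
    refine (Submodule.rank_mono h1).trans_lt ?_
    rw [← Module.finrank_eq_rank]
    exact_mod_cast Nat.lt_succ_self _
  have hle : ‖T - R‖ ≤ ε / 2 := by
    refine ContinuousLinearMap.opNorm_le_of_unit_norm (𝕜 := ℂ) (half_pos hε).le fun x hx => ?_
    obtain ⟨y, hy, hxy⟩ : ∃ y ∈ t, T x ∈ Metric.ball y (ε / 2) := by
      simpa using hcov ⟨x, by simp [hx], rfl⟩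
    have h1 : ‖T x - V.starProjection (T x)‖ ≤ ‖T x - y‖ := by
      rw [Submodule.starProjection_minimal]
      exact ciInf_le ⟨0, by rintro _ ⟨w, rfl⟩; exact norm_nonneg _⟩
        (⟨y, Submodule.subset_span hy⟩ : V)
    exact h1.trans (mem_ball_iff_norm.1 hxy).le
  refine ⟨Module.finrank ℂ V + 1, fun n hn => ?_⟩
  rw [Real.dist_eq, sub_zero, abs_of_nonneg (approximationNumber_nonneg T n)]
  have := (approximationNumber_anti T (by omega) hn).trans (approximationNumber_le T R hrank)
  linarith

theorem isCompactOperator_of_finiteDimensional_range (R : H →L[ℂ] H)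
    [FiniteDimensional ℂ (LinearMap.range R.toLinearMap)] : IsCompactOperator R := by
  let R' : H →L[ℂ] LinearMap.range R.toLinearMap :=
    R.codRestrict _ fun x => ⟨x, rfl⟩
  have : ProperSpace (LinearMap.range R.toLinearMap) := FiniteDimensional.proper ℂ _
  have h : IsCompactOperator ((Submodule.subtypeL (LinearMap.range R.toLinearMap)) ∘ R') :=
    (isCompactOperator_of_locallyCompactSpace_dom R').clm_comp _
  exact h

theorem isCompactOperator_of_approximationNumber [CompleteSpace H] {T : H →L[ℂ] H}
    (h : ∀ ε > 0, ∃ n ≥ 1, approximationNumber T n < ε) : IsCompactOperator T := by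
  have : T ∈ closure {S : H →L[ℂ] H | IsCompactOperator S} := by
    refine Metric.mem_closure_iff.2 fun ε hε => ?_
    obtain ⟨n, hn, hlt⟩ := h ε hε
    obtain ⟨R, hR, hTR⟩ := exists_norm_sub_lt T hn hlt
    have : FiniteDimensional ℂ (LinearMap.range R.toLinearMap) :=
      Module.rank_lt_aleph0_iff.1 (hR.trans Cardinal.natCast_lt_aleph0)
    exact ⟨R, isCompactOperator_of_finiteDimensional_range R, by rwa [dist_eq_norm]⟩
  rwa [IsClosed.closure_eq isClosed_setOfPred_isCompactOperator] at this

end Compactness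

/-! ### Consequences of log-subordination -/

section LogSubordination

variable {u v : ℕ → ℝ}

/-- Since `u` is non-increasing, `u (2n) ^ (2n)` is at most the product of the first `2n` terms of
`u`, hence of `v`. In the latter, the first `n` factors are at most `v 1` and the others at most `v
n`; an `n`-th root finishes. -/
theorem LogSubordinate.two_mul_le (h : LogSubordinate u v) (hu0 : ∀ n, 0 ≤ u n)
    (hv0 : ∀ n, 0 ≤ v n) (hu : ∀ m n, 1 ≤ m → m ≤ n → u n ≤ u m)
    (hv : ∀ m n, 1 ≤ m → m ≤ n → v n ≤ v m) {n : ℕ} (hn : 1 ≤ n) :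
    u (2 * n) ≤ √(v 1) * √(v n) := by
  rw [← Real.sqrt_mul (hv0 1)]
  refine Real.le_sqrt_of_sq_le ?_
  refine le_of_pow_le_pow_left₀ (n := n) (by omega) (mul_nonneg (hv0 _) (hv0 _)) ?_
  have h1 : u (2 * n) ^ (2 * n) ≤ ∏ j ∈ Finset.Icc 1 (2 * n), u j := by
    rw [prod_Icc_one_eq_prod_range]
    refine le_of_eq_of_le (by simp) (Finset.prod_le_prod (s := Finset.range (2 * n))
      (fun _ _ => hu0 (2 * n)) fun i hi => hu (i + 1) (2 * n) (by omega) ?_)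
    have := Finset.mem_range.1 hi
    omega
  have h2 : ∏ j ∈ Finset.Icc 1 (2 * n), v j ≤ v 1 ^ n * v n ^ n := by
    rw [prod_Icc_one_eq_prod_range, two_mul, Finset.prod_range_add]
    refine mul_le_mul ?_ ?_ (Finset.prod_nonneg fun _ _ => hv0 _) (pow_nonneg (hv0 _) _)
    · refine (Finset.prod_le_prod (fun _ _ => hv0 _)
        (fun i _ => hv 1 (i + 1) le_rfl (by omega))).trans_eq (by simp)
    · refine (Finset.prod_le_prod (fun _ _ => hv0 _)
        (fun i _ => hv n (n + i + 1) hn (by omega))).trans_eq (by simp)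
  rw [← pow_mul, mul_pow]
  exact h1.trans ((h (2 * n) (by omega)).trans h2)

/-- Abel summation: replacing `w n` by the smaller `w (n + 1)` in front of a nonnegative partial sum
can only decrease it. -/
theorem le_sum_mul_of_sum_nonneg {w d : ℕ → ℝ} (hw : Antitone w)
    (hd : ∀ n, 0 ≤ ∑ i ∈ Finset.range n, d i) (n : ℕ) :
    w n * ∑ i ∈ Finset.range n, d i ≤ ∑ i ∈ Finset.range n, w i * d i := by
  induction n with
  | zero => simp
  | succ n ih =>
    have h1 := mul_le_mul_of_nonneg_right (hw n.le_succ) (hd (n + 1))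
    rw [Finset.sum_range_succ (fun i => w i * d i)]
    rw [Finset.sum_range_succ, mul_add] at h1 ⊢
    linarith

/-- Log-majorization of non-increasing sequences implies weak majorization (Weyl). -/
theorem sum_range_le_of_prod_range_le {u v : ℕ → ℝ} (hu0 : ∀ n, 0 ≤ u n) (hv0 : ∀ n, 0 ≤ v n)
    (hu : Antitone u)
    (h : ∀ n, ∏ i ∈ Finset.range n, u i ≤ ∏ i ∈ Finset.range n, v i) (n : ℕ) :
    ∑ i ∈ Finset.range n, u i ≤ ∑ i ∈ Finset.range n, v i := by
  induction n with
  | zero => simp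
  | succ n ih =>
    rcases (hu0 n).eq_or_lt with hn | hn
    · rw [Finset.sum_range_succ, Finset.sum_range_succ, ← hn]
      linarith [hv0 n]
    · have hupos : ∀ i < n + 1, 0 < u i := fun i hi => hn.trans_le (hu (by omega))
      have hvpos : ∀ i < n + 1, 0 < v i := fun i hi => by
        refine (hv0 i).lt_of_ne fun h0 => ?_
        have h1 : 0 < ∏ j ∈ Finset.range (n + 1), u j :=
          Finset.prod_pos fun j hj => hupos j (Finset.mem_range.1 hj)
        exact absurd (h1.trans_le (h (n + 1)))
          (Finset.prod_eq_zero (Finset.mem_range.2 hi) h0.symm).le.not_gt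
      -- Log-majorization says that the partial sums of `log (v i / u i)` are nonnegative; the value
      -- `0` beyond `n` keeps this true for all lengths. Abel summation with weights `u i`, then `u
      -- * log (v / u) ≤ v - u`, gives the comparison of sums.
      let d : ℕ → ℝ := fun i => if i < n + 1 then Real.log (v i / u i) else 0
      have hd : ∀ m, 0 ≤ ∑ i ∈ Finset.range m, d i := by
        intro m
        have hle : ∀ m ≤ n + 1, 0 ≤ ∑ i ∈ Finset.range m, d i := by
          intro m hm
          have h1 : ∑ i ∈ Finset.range m, d i =
              Real.log (∏ i ∈ Finset.range m, v i / u i) := by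
            rw [Real.log_prod]
            · refine Finset.sum_congr rfl fun i hi => ?_
              have := Finset.mem_range.1 hi
              simp only [d, if_pos (show i < n + 1 by omega)]
            · intro i hi
              have := Finset.mem_range.1 hi
              exact (div_pos (hvpos i (by omega)) (hupos i (by omega))).ne'
          rw [h1, Finset.prod_div_distrib]
          refine Real.log_nonneg ?_
          rw [one_le_div]
          · exact h m
          · refine Finset.prod_pos fun i hi => hupos i ?_
            have := Finset.mem_range.1 hi
            omega
        rcases le_total m (n + 1) with hm | hm
        · exact hle m hm
        · rw [← Finset.sum_subset (Finset.range_mono hm)]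
          · exact hle _ le_rfl
          · intro i _ hi
            simp only [Finset.mem_range] at hi
            simp only [d, if_neg hi]
      have h1 := le_sum_mul_of_sum_nonneg hu hd (n + 1)
      have h2 : 0 ≤ ∑ i ∈ Finset.range (n + 1), u i * d i :=
        (mul_nonneg (hu0 _) (hd _)).trans h1
      have h3 : ∑ i ∈ Finset.range (n + 1), u i * d i ≤
          ∑ i ∈ Finset.range (n + 1), (v i - u i) := by
        refine Finset.sum_le_sum fun i hi => ?_
        have hi := Finset.mem_range.1 hi
        have hui := hupos i hi
        simp only [d, if_pos hi]
        have := Real.log_le_sub_one_of_pos (div_pos (hvpos i hi) hui)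
        calc u i * Real.log (v i / u i) ≤ u i * (v i / u i - 1) := by gcongr
          _ = v i - u i := by field_simp
      rw [Finset.sum_sub_distrib] at h3
      linarith

theorem LogSubordinate.summable_rpow (h : LogSubordinate u v) (hu0 : ∀ n, 0 ≤ u n)
    (hv0 : ∀ n, 0 ≤ v n) (hu : ∀ m n, 1 ≤ m → m ≤ n → u n ≤ u m) {p : ℝ} (hp : 0 < p)
    (hs : Summable fun n => v (n + 1) ^ p) : Summable fun n => u (n + 1) ^ p := by
  refine summable_of_sum_range_le (c := ∑' n, v (n + 1) ^ p)
    (fun n => Real.rpow_nonneg (hu0 _) p) fun n => ?_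
  refine le_trans ?_ (hs.sum_le_tsum (Finset.range n) fun i _ => Real.rpow_nonneg (hv0 _) p)
  refine sum_range_le_of_prod_range_le (fun n => Real.rpow_nonneg (hu0 _) p)
    (fun n => Real.rpow_nonneg (hv0 _) p) ?_ ?_ n
  · intro m n hmn
    exact Real.rpow_le_rpow (hu0 _) (hu _ _ (by omega) (by omega)) hp.le
  · intro n
    rw [Real.finsetProd_rpow _ _ fun _ _ => hu0 _, Real.finsetProd_rpow _ _ fun _ _ => hv0 _]
    refine Real.rpow_le_rpow (Finset.prod_nonneg fun _ _ => hu0 _) ?_ hp.le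
    rcases n.eq_zero_or_pos with rfl | hn
    · simp
    · simpa only [prod_Icc_one_eq_prod_range] using h n hn

end LogSubordination

/-! ### Analytic interpolation of conjugated matrices -/

section ScaledMatrices

variable {ι : Type*} [Fintype ι]

/-- The matrix of the values of the sesquilinear form with coefficients `a` on two families. -/
noncomputable def formMatrix {n : ℕ} (a : ι → ι → ℂ) (x y : Fin n → EuclideanSpace ℂ ι) :
    Matrix (Fin n) (Fin n) ℂ :=
  Matrix.of fun l i => ∑ j, ∑ k, star (y l j) * a j k * x i k

/-- If `a j k = 0` unless `μ k ≤ μ j`, a bound for the mixed Gram determinants of the matrix `a`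
is also one for the matrix `D⁻¹ a D`, where `D` is diagonal with entries `exp (μ k)`.  The
determinants of `D ^ (-z) a D ^ z` are bounded and analytic in `0 ≤ re z`, and `D ^ z` is unitary
on the boundary. -/
theorem norm_det_formMatrix_scaled_le {n : ℕ} {a : ι → ι → ℂ} {μ : ι → ℝ} {K : ℝ}
    (ha : ∀ j k, a j k ≠ 0 → μ k ≤ μ j)
    (hK : ∀ x y : Fin n → EuclideanSpace ℂ ι,
      ‖(formMatrix a x y).det‖ ≤ K * ((∏ i, ‖x i‖) * ∏ i, ‖y i‖))
    (x y : Fin n → EuclideanSpace ℂ ι) :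
    ‖(formMatrix (fun j k => Complex.exp ((μ k : ℂ) - μ j) * a j k) x y).det‖ ≤
      K * ((∏ i, ‖x i‖) * ∏ i, ‖y i‖) := by
  let A : ℂ → ι → ι → ℂ := fun z j k => Complex.exp (z * ((μ k : ℂ) - μ j)) * a j k
  let G : ℂ → ℂ := fun z => (formMatrix (A z) x y).det
  -- A crude bound from the Leibniz formula: only its independence of `z` matters.
  let C : ℝ := ∑ σ : Equiv.Perm (Fin n),
    ∏ i, ∑ j, ∑ k, ‖y (σ i) j‖ * ‖a j k‖ * ‖x i k‖
  have hdiff : Differentiable ℂ G := by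
    simp only [G, Matrix.det_apply, formMatrix, Matrix.of_apply, A]
    refine Differentiable.fun_sum fun σ _ => Differentiable.fun_const_smul ?_ _
    refine Differentiable.fun_finsetProd fun i _ => ?_
    fun_prop
  have hA : ∀ z : ℂ, 0 ≤ z.re → ∀ j k, ‖A z j k‖ ≤ ‖a j k‖ := by
    intro z hz j k
    by_cases h0 : a j k = 0
    · simp [A, h0]
    · have h1 : ‖Complex.exp (z * ((μ k : ℂ) - μ j))‖ ≤ 1 := by
        rw [Complex.norm_exp, Real.exp_le_one_iff, ← Complex.ofReal_sub, Complex.re_mul_ofReal]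
        exact mul_nonpos_of_nonneg_of_nonpos hz (sub_nonpos.2 (ha j k h0))
      simp only [A, norm_mul]
      exact mul_le_of_le_one_left (norm_nonneg _) h1
  have hbdd : ∀ z : ℂ, 0 ≤ z.re → ‖G z‖ ≤ C := by
    intro z hz
    simp only [G, Matrix.det_apply]
    refine norm_sum_le_of_le _ fun σ _ => ?_
    have hs : ‖Equiv.Perm.sign σ • ∏ i, formMatrix (A z) x y (σ i) i‖ =
        ∏ i, ‖formMatrix (A z) x y (σ i) i‖ := by
      rcases Int.units_eq_one_or (Equiv.Perm.sign σ) with h | h <;> simp [h]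
    rw [hs]
    refine Finset.prod_le_prod (fun _ _ => norm_nonneg _) fun i _ => ?_
    refine norm_sum_le_of_le _ fun j _ => norm_sum_le_of_le _ fun k _ => ?_
    rw [norm_mul, norm_mul, norm_star]
    gcongr
    exact hA z hz j k
  have him : ∀ t : ℝ, ‖G (t * Complex.I)‖ ≤ K * ((∏ i, ‖x i‖) * ∏ i, ‖y i‖) := by
    intro t
    -- `e` is the diagonal of `D ^ (it)`. This unitary can be moved from the matrix onto both
    -- families of vectors without changing their norms.
    let e : ι → ℂ := fun k => Complex.exp ((t * μ k : ℝ) * Complex.I)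
    have he : ∀ k, ‖e k‖ = 1 := fun k => Complex.norm_exp_ofReal_mul_I _
    let r : EuclideanSpace ℂ ι → EuclideanSpace ℂ ι := fun w => WithLp.toLp 2 fun k => e k * w k
    have hr : ∀ w, ‖r w‖ = ‖w‖ := fun w => by
      simp [r, EuclideanSpace.norm_eq, he]
    have hG : G (t * Complex.I) =
        (formMatrix a (fun i => r (x i)) (fun i => r (y i))).det := by
      refine congrArg Matrix.det ?_
      ext l i
      refine Finset.sum_congr rfl fun j _ => Finset.sum_congr rfl fun k _ => ?_
      have hexp : Complex.exp (t * Complex.I * ((μ k : ℂ) - μ j)) = star (e j) * e k := by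
        simp only [e, Complex.star_def, ← Complex.exp_conj, ← Complex.exp_add]
        congr 1
        simp
        ring
      simp only [A, r, hexp, star_mul']
      ring
    rw [hG]
    refine (hK _ _).trans_eq ?_
    simp only [hr]
  -- Boundedness supplies the growth condition with exponent `0` and constant `0`; the value at `1`
  -- is the determinant sought.
  have hG1 := PhragmenLindelof.right_half_plane_of_bounded_on_real (f := G) (z := 1)
    (hdiff.diffContOnCl) ⟨0, by norm_num, 0, ?_⟩ ?_ him (by simp)
  · simpa [G, A] using hG1
  · refine Asymptotics.IsBigO.of_bound C ?_
    filter_upwards [Filter.mem_inf_of_right (Filter.mem_principal_self _)] with z hz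
    simpa using hbdd z (le_of_lt hz)
  · exact Filter.isBoundedUnder_of_eventually_le (a := C)
      (by filter_upwards [Filter.eventually_ge_atTop 0] with t ht using hbdd t (by simpa using ht))

end ScaledMatrices

/-! ### From finite sections to operators -/

section OrthonormalSections

variable {H : Type*} [NormedAddCommGroup H] [InnerProductSpace ℂ H]

theorem GramDetBound.norm_det_formMatrix_le {A : H →L[ℂ] H} {n : ℕ} {K : ℝ}
    (hA : GramDetBound A n K) {e : ℕ → H} (he : Orthonormal ℂ e) (N : ℕ)
    (x y : Fin n → EuclideanSpace ℂ (Fin N)) :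
    ‖(formMatrix (fun j k : Fin N => inner ℂ (e j) (A (e k))) x y).det‖ ≤
      K * ((∏ i, ‖x i‖) * ∏ i, ‖y i‖) := by
  let J : EuclideanSpace ℂ (Fin N) → H := fun w => ∑ k : Fin N, w k • e k
  have hJ : ∀ w, ‖J w‖ = ‖w‖ := by
    intro w
    rw [← sq_eq_sq₀ (norm_nonneg _) (norm_nonneg _), EuclideanSpace.norm_sq_eq]
    exact (he.comp (fun k : Fin N => (k : ℕ)) Fin.val_injective).norm_sum_smul_sq _ Finset.univ
  have hM : formMatrix (fun j k : Fin N => inner ℂ (e j) (A (e k))) x y =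
      Matrix.of fun l i => inner ℂ (J (y l)) (A (J (x i))) := by
    ext l i
    simp only [formMatrix, Matrix.of_apply, J, map_sum, map_smul, sum_inner, inner_sum,
      inner_smul_left, inner_smul_right]
    rw [Finset.sum_comm]
    refine Finset.sum_congr rfl fun j _ => ?_
    rw [Finset.mul_sum]
    refine Finset.sum_congr rfl fun k _ => ?_
    simp only [starRingEnd_apply]
    ring
  rw [hM]
  refine (hA _ _).trans_eq ?_
  simp only [hJ]

variable {H' : Type*} [NormedAddCommGroup H'] [InnerProductSpace ℂ H']

/-- If the matrix of `B` is the matrix of `A` conjugated by the diagonal matrix with entries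
`exp (μ k)`, in the way that makes its entries smaller, then `B` inherits the bounds for mixed Gram
determinants from `A`. -/
theorem GramDetBound.of_scaled {A : H →L[ℂ] H} {B : H' →L[ℂ] H'} {n : ℕ} {K : ℝ}
    (hK0 : 0 ≤ K) (hA : GramDetBound A n K) {e : ℕ → H} (he : Orthonormal ℂ e)
    (e' : HilbertBasis ℕ ℂ H') {μ : ℕ → ℝ}
    (hμ : ∀ j k, inner ℂ (e j) (A (e k)) ≠ 0 → μ k ≤ μ j)
    (hB : ∀ j k, inner ℂ (e' j) (B (e' k)) =
      Complex.exp ((μ k : ℂ) - μ j) * inner ℂ (e j) (A (e k))) :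
    GramDetBound B n K := by
  intro x y
  let c : ∀ N : ℕ, H' → EuclideanSpace ℂ (Fin N) := fun N w =>
    WithLp.toLp 2 fun k => inner ℂ (e' k) w
  let P : ℕ → H' → H' := fun N w => ∑ k ∈ Finset.range N, (inner ℂ (e' k) w : ℂ) • e' k
  have hP : ∀ w, Filter.Tendsto (fun N => P N w) Filter.atTop (nhds w) := fun w => by
    have := (e'.hasSum_repr w).tendsto_sum_nat
    simpa only [HilbertBasis.repr_apply_apply] using this
  have hc : ∀ N w, ‖c N w‖ ≤ ‖w‖ := fun N w => by
    refine le_of_sq_le_sq ?_ (norm_nonneg _)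
    rw [EuclideanSpace.norm_sq_eq]
    have := e'.orthonormal.sum_inner_products_le (s := Finset.range N) w
    rwa [Finset.sum_range] at this
  have hN : ∀ N, ‖(Matrix.of fun l i => inner ℂ (P N (y l)) (B (P N (x i)))).det‖ ≤
      K * ((∏ i, ‖x i‖) * ∏ i, ‖y i‖) := by
    intro N
    have h1 := norm_det_formMatrix_scaled_le (μ := fun k : Fin N => μ k)
      (fun j k h => hμ j k h) (hA.norm_det_formMatrix_le he N) (fun i => c N (x i))
      (fun i => c N (y i))
    have hM : formMatrix (fun j k : Fin N => Complex.exp ((μ k : ℂ) - μ j) *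
        inner ℂ (e j) (A (e k))) (fun i => c N (x i)) (fun i => c N (y i)) =
        Matrix.of fun l i => inner ℂ (P N (y l)) (B (P N (x i))) := by
      ext l i
      simp only [formMatrix, Matrix.of_apply, P, Finset.sum_range, map_sum, map_smul, sum_inner,
        inner_sum, inner_smul_left, inner_smul_right, hB, c]
      rw [Finset.sum_comm]
      refine Finset.sum_congr rfl fun j _ => ?_
      rw [Finset.mul_sum]
      refine Finset.sum_congr rfl fun k _ => ?_
      simp only [starRingEnd_apply]
      ring
    rw [← hM]
    refine h1.trans (mul_le_mul_of_nonneg_left ?_ hK0)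
    gcongr with i _ i _
    · exact hc _ _
    · exact hc _ _
  have hcont : Continuous fun p : (Fin n → H') × (Fin n → H') =>
      ‖(Matrix.of fun l i => inner ℂ (p.2 l) (B (p.1 i))).det‖ := by
    refine continuous_norm.comp (Continuous.matrix_det ?_)
    refine continuous_matrix fun l i => ?_
    simp only [Matrix.of_apply]
    fun_prop
  have hlim : Filter.Tendsto (fun N => ((fun i => P N (x i), fun i => P N (y i)) :
      (Fin n → H') × (Fin n → H'))) Filter.atTop (nhds (x, y)) :=
    (tendsto_pi_nhds.2 fun i => hP (x i)).prodMk_nhds (tendsto_pi_nhds.2 fun i => hP (y i))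
  exact le_of_tendsto ((hcont.tendsto (x, y)).comp hlim) (Filter.Eventually.of_forall hN)

end OrthonormalSections

/-! ### Taylor coefficients of composed functions -/

section TaylorSeries

theorem exists_isTaylor {F : ℂ → ℂ} (hF : DifferentiableOn ℂ F (Metric.ball 0 1)) :
    ∃ c, IsTaylor c (fun z : Disk => F z) := by
  refine ⟨fun n => ((n.factorial : ℂ)⁻¹) * iteratedDeriv n F 0, fun z => ?_⟩
  have h := Complex.hasSum_taylorSeries_on_ball hF z.2
  refine h.congr_fun fun n => ?_
  simp only [smul_eq_mul, sub_zero]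
  ring

/-- For `r < 1` the terms `c k * r ^ k` tend to `0`, so the radius of convergence is at least `1`.
-/
theorem IsTaylor.exists_differentiableOn {c : ℕ → ℂ} {f : Disk → ℂ} (hc : IsTaylor c f) :
    ∃ F : ℂ → ℂ, DifferentiableOn ℂ F (Metric.ball 0 1) ∧ ∀ z : Disk, F z = f z := by
  let F : ℂ → ℂ := fun z => ∑' k, c k * z ^ k
  refine ⟨F, ?_, fun z => (hc z).tsum_eq⟩
  have h : HasFPowerSeriesOnBall F (FormalMultilinearSeries.ofScalars ℂ c) 0 1 := by
    refine ⟨?_, one_pos, ?_⟩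
    · refine ENNReal.le_of_forall_nnreal_lt fun r hr => ?_
      have hr1 : (r : ℝ) < 1 := by exact_mod_cast hr
      have hz : ((r : ℝ) : ℂ) ∈ Metric.ball (0 : ℂ) 1 := by simpa using hr1
      refine FormalMultilinearSeries.le_radius_of_tendsto _ (l := 0) ?_
      have := (hc ⟨_, hz⟩).summable.tendsto_atTop_zero.norm
      simpa [FormalMultilinearSeries.ofScalars_norm] using this
    · intro z hz
      have hz' : z ∈ Metric.ball (0 : ℂ) 1 := by simpa [← ofReal_norm] using hz
      have := (hc ⟨z, hz'⟩).summable.hasSum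
      simpa [FormalMultilinearSeries.ofScalars_apply_eq, F, mul_comm] using this
  have h2 := h.differentiableOn
  rwa [← ENNReal.ofReal_one, Metric.eball_ofReal] at h2

theorem IsTaylor.shift {c : ℕ → ℂ} {f : Disk → ℂ} (hc : IsTaylor c f) (N : ℕ) :
    IsTaylor (fun k => if k < N then 0 else c (k - N)) (fun z => (z : ℂ) ^ N * f z) := by
  intro z
  have h0 : ∑ k ∈ Finset.range N, (if k < N then 0 else c (k - N)) * (z : ℂ) ^ k = 0 :=
    Finset.sum_eq_zero fun k hk => by simp [Finset.mem_range.1 hk]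
  rw [← hasSum_nat_add_iff' N, h0, sub_zero]
  refine ((hc z).mul_left ((z : ℂ) ^ N)).congr_fun fun k => ?_
  simp only [show ¬ k + N < N by omega, if_false, Nat.add_sub_cancel]
  ring

theorem IsTaylor.exists_tail {c : ℕ → ℂ} {f : Disk → ℂ} (hc : IsTaylor c f) (N : ℕ) :
    ∃ h : Disk → ℂ, IsTaylor (fun k => c (k + N)) h ∧
      ∀ z : Disk, f z = ∑ k ∈ Finset.range N, c k * (z : ℂ) ^ k + (z : ℂ) ^ N * h z := by
  have hs : ∀ z : Disk, Summable fun k => c (k + N) * (z : ℂ) ^ k := by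
    intro z
    by_cases hz : (z : ℂ) = 0
    · refine summable_of_ne_finset_zero (s := {0}) fun k hk => ?_
      rw [hz, zero_pow (by simpa using hk), mul_zero]
    · have h1 := ((summable_nat_add_iff N).2 (hc z).summable).mul_left ((z : ℂ) ^ N)⁻¹
      refine h1.congr fun k => ?_
      rw [pow_add]
      field_simp
  refine ⟨fun z => ∑' k, c (k + N) * (z : ℂ) ^ k, fun z => (hs z).hasSum, fun z => ?_⟩
  have h1 := ((hs z).hasSum.mul_left ((z : ℂ) ^ N)).congr_fun
    (g := fun k => c (k + N) * (z : ℂ) ^ (k + N)) fun k => by ring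
  have h2 := (hasSum_nat_add_iff' N).2 (hc z)
  rw [h1.unique h2]
  ring

theorem IsTaylor.apply_zero {c : ℕ → ℂ} {f : Disk → ℂ} (hc : IsTaylor c f) :
    f ⟨0, by simp⟩ = c 0 := by
  obtain ⟨h, -, hf⟩ := hc.exists_tail 1
  rw [hf]
  simp

/-- The Taylor coefficients of `f ∘ φ`, where `φ 0 = 0`, are given by a lower triangular matrix
whose columns are the Taylor coefficients of the powers of `φ`. -/
theorem IsTaylor.exists_comp {φ : ℂ → ℂ} (hφ : DifferentiableOn ℂ φ (Metric.ball 0 1))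
    (hmaps : Set.MapsTo φ (Metric.ball 0 1) (Metric.ball 0 1)) (h0 : φ 0 = 0)
    {m : ℕ → ℕ → ℂ} (hm : ∀ k, IsTaylor (fun j => m j k) fun z => φ z ^ k)
    {c : ℕ → ℂ} {f : Disk → ℂ} (hc : IsTaylor c f) :
    ∃ b, IsTaylor b (fun z => f (hmaps.restrict _ _ _ z)) ∧
      ∀ N, ∀ j < N, b j = ∑ k ∈ Finset.range N, m j k * c k := by
  have hcomp : ∀ {d : ℕ → ℂ} {g : Disk → ℂ}, IsTaylor d g →
      ∃ G : ℂ → ℂ, DifferentiableOn ℂ G (Metric.ball 0 1) ∧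
        ∀ z : Disk, G z = g (hmaps.restrict _ _ _ z) := by
    intro d g hd
    obtain ⟨G, hG, hGg⟩ := hd.exists_differentiableOn
    exact ⟨G ∘ φ, hG.comp hφ hmaps, fun z => hGg (hmaps.restrict _ _ _ z)⟩
  obtain ⟨F, hF, hFf⟩ := hcomp hc
  obtain ⟨b, hb⟩ := exists_isTaylor hF
  simp only [hFf] at hb
  refine ⟨b, hb, fun N j hj => ?_⟩
  -- Write `φ = z ψ` and `f = (polynomial of degree < N) + z ^ N h`. After composition the remainder
  -- is `z ^ N ψ ^ N (h ∘ φ)`, which contributes nothing to the coefficients below `N`.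
  obtain ⟨p, hp⟩ := exists_isTaylor hφ
  obtain ⟨ψ, hψ, hφψ⟩ := hp.exists_tail 1
  have hp0 : p 0 = 0 := by rw [← hp.apply_zero]; exact h0
  have hφψ' : ∀ z : Disk, φ z = z * ψ z := fun z => by simpa [hp0] using hφψ z
  obtain ⟨Ψ, hΨ, hΨψ⟩ := hψ.exists_differentiableOn
  obtain ⟨h, hh, hfh⟩ := hc.exists_tail N
  obtain ⟨G, hG, hGh⟩ := hcomp hh
  obtain ⟨q, hq⟩ := exists_isTaylor ((hΨ.pow N).mul hG)
  have hsum : IsTaylor (fun j => ∑ k ∈ Finset.range N, m j k * c k +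
      if j < N then 0 else q (j - N)) (fun z => f (hmaps.restrict _ _ _ z)) := by
    intro z
    have h1 := (hasSum_sum fun k (_ : k ∈ Finset.range N) => (hm k z).mul_left (c k)).add
      (hq.shift N z)
    have h2 : f (hmaps.restrict _ _ _ z) = ∑ k ∈ Finset.range N, c k * φ z ^ k +
        (z : ℂ) ^ N * (Ψ ^ N * G) z := by
      rw [hfh]
      simp only [Pi.mul_apply, Pi.pow_apply, hΨψ, hGh]
      rw [← mul_assoc, ← mul_pow, ← hφψ']
      rfl
    beta_reduce
    rw [h2]
    refine h1.congr_fun fun j => ?_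
    rw [add_mul, Finset.sum_mul]
    congr 1
    exact Finset.sum_congr rfl fun k _ => by ring
  have := congrFun (hb.unique hsum) j
  simpa [hj] using this

end TaylorSeries

/-! ### Monomial basis and operators on the weighted spaces -/

namespace H2

variable {β : Weight}

/-- The isometry of `H²(β)` onto `ℓ²`. -/
noncomputable def toL2Equiv (β : Weight) : H2 β ≃ₗᵢ[ℂ] lp (fun _ : ℕ => ℂ) 2 :=
  LinearIsometryEquiv.ofSurjective ⟨toL2, fun _ => rfl⟩ toL2_surjective

/-- The orthonormal basis of the normalized monomials `z ^ k / √β_k`. -/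
noncomputable def basis (β : Weight) : HilbertBasis ℕ ℂ (H2 β) := HilbertBasis.ofRepr (toL2Equiv β)

theorem inner_basis (f : H2 β) (k : ℕ) :
    inner ℂ (basis β k) f = ((√(β.seq k) : ℝ) : ℂ) * f.coeff k := by
  rw [← HilbertBasis.repr_apply_apply]
  rfl

theorem sqrt_ne_zero (β : Weight) (k : ℕ) : ((√(β.seq k) : ℝ) : ℂ) ≠ 0 := by
  exact_mod_cast (Real.sqrt_pos.2 (β.pos k)).ne'

theorem basis_apply (k : ℕ) (z : Disk) :
    basis β k z = ((√(β.seq k) : ℝ) : ℂ)⁻¹ * (z : ℂ) ^ k := by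
  have hne := sqrt_ne_zero β
  have hc : ∀ j, (basis β k).coeff j = if j = k then ((√(β.seq k) : ℝ) : ℂ)⁻¹ else 0 := by
    intro j
    have h1 := inner_basis (basis β k) j
    rw [orthonormal_iff_ite.1 (basis β).orthonormal] at h1
    refine mul_left_cancel₀ (hne j) (h1.symm.trans ?_)
    split_ifs with h
    · rw [h, mul_inv_cancel₀ (hne k)]
    · rw [mul_zero]
  refine ((basis β k).isTaylor z).unique ?_
  have := hasSum_single (f := fun j => (basis β k).coeff j * (z : ℂ) ^ j) k fun j hj => by
    simp [hc, hj]
  simpa [hc] using this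

theorem coeff_eq_of_isTaylor {f : H2 β} {c : ℕ → ℂ} (h : IsTaylor c f) : f.coeff = c :=
  f.isTaylor.unique h

theorem sq_norm_eq_sum (c : ℕ → ℂ) (N : ℕ) :
    ‖(WithLp.toLp 2 fun k : Fin N => ((√(β.seq k) : ℝ) : ℂ) * c k : EuclideanSpace ℂ (Fin N))‖ ^ 2 =
      ∑ k ∈ Finset.range N, β.seq k * ‖c k‖ ^ 2 := by
  rw [EuclideanSpace.norm_sq_eq, Finset.sum_range]
  refine Finset.sum_congr rfl fun k _ => ?_
  simp [mul_pow, Real.sq_sqrt (β.pos k).le]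

/-- A function whose weighted partial sums are dominated belongs to `H²(β)`. -/
theorem exists_of_sum_le {c : ℕ → ℂ} {f : Disk → ℂ} (hc : IsTaylor c f) {C : ℝ} (hC0 : 0 ≤ C)
    (hC : ∀ N, ∑ k ∈ Finset.range N, β.seq k * ‖c k‖ ^ 2 ≤ C ^ 2) :
    ∃ g : H2 β, (∀ z, g z = f z) ∧ ‖g‖ ≤ C := by
  have hnn : ∀ k, 0 ≤ β.seq k * ‖c k‖ ^ 2 := fun k => mul_nonneg (β.pos k).le (sq_nonneg _)
  have hs := summable_of_sum_range_le hnn hC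
  let g : H2 β := ⟨f, c, hc, hs⟩
  refine ⟨g, fun _ => rfl, le_of_sq_le_sq ?_ hC0⟩
  have hg : g.coeff = c := coeff_eq_of_isTaylor hc
  rw [norm_sq, hg]
  exact hs.tsum_le_of_sum_range_le hC

theorem exists_clm {γ : Weight} (g : H2 β → Disk → ℂ)
    (hadd : ∀ f₁ f₂ z, g (f₁ + f₂) z = g f₁ z + g f₂ z)
    (hsmul : ∀ (a : ℂ) f z, g (a • f) z = a * g f z) {C : ℝ} (hC : 0 ≤ C)
    (h : ∀ f, ∃ G : H2 γ, (∀ z, G z = g f z) ∧ ‖G‖ ≤ C * ‖f‖) :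
    ∃ T : H2 β →L[ℂ] H2 γ, (∀ f z, T f z = g f z) ∧ ‖T‖ ≤ C := by
  choose G hG hn using h
  let T : H2 β →ₗ[ℂ] H2 γ :=
    { toFun := G
      map_add' := fun f₁ f₂ => by
        ext z
        change _ = G f₁ z + G f₂ z
        rw [hG, hG, hG, hadd]
      map_smul' := fun a f => by
        ext z
        change _ = a * G f z
        rw [hG, hG, hsmul] }
  exact ⟨T.mkContinuous C hn, hG, T.mkContinuous_norm_le hC hn⟩

theorem exists_inclusion (β γ : Weight) (hmono : Monotone fun k => β.seq k / γ.seq k) :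
    ∃ ι : H2 β →L[ℂ] H2 γ, ∀ (f : H2 β) (z : Disk), ι f z = f z := by
  -- By monotonicity the ratio `γ_k / β_k` is largest at `k = 0`.
  set C := γ.seq 0 / β.seq 0 with hCdef
  have hC : 0 < C := div_pos (γ.pos 0) (β.pos 0)
  have hle : ∀ k, γ.seq k ≤ C * β.seq k := by
    intro k
    have h1 : β.seq 0 / γ.seq 0 ≤ β.seq k / γ.seq k := hmono (Nat.zero_le k)
    rw [div_le_div_iff₀ (γ.pos 0) (γ.pos k)] at h1
    rw [hCdef, div_mul_eq_mul_div, le_div_iff₀ (β.pos 0)]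
    linarith
  obtain ⟨T, hT, -⟩ := exists_clm (γ := γ) (fun f : H2 β => fun z => f z) (fun _ _ _ => rfl)
    (fun _ _ _ => rfl) (Real.sqrt_nonneg C) fun f => by
      refine exists_of_sum_le f.isTaylor (by positivity) fun N => ?_
      rw [mul_pow, Real.sq_sqrt hC.le, norm_sq, ← tsum_mul_left]
      refine le_trans (Finset.sum_le_sum fun k _ => ?_) ((f.summable.mul_left C).sum_le_tsum
        (Finset.range N) fun k _ => mul_nonneg hC.le (mul_nonneg (β.pos k).le (sq_nonneg _)))
      rw [← mul_assoc]
      gcongr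
      exact hle k
  exact ⟨T, hT⟩

end H2

/-! ### Comparison of composition operators for two weights -/

section CompositionOperators

variable {φ : ℂ → ℂ}

/-- The matrix of a composition operator in the bases of normalized monomials, in terms of the
Taylor coefficients `m · k` of `φ ^ k`. -/
theorem IsCompositionOperator.inner_basis {φ : Disk → Disk} {β : Weight} {T : H2 β →L[ℂ] H2 β}
    (hT : IsCompositionOperator φ T) {m : ℕ → ℕ → ℂ}
    (hm : ∀ k, IsTaylor (fun j => m j k) fun z => (φ z : ℂ) ^ k) (j k : ℕ) :
    inner ℂ (H2.basis β j) (T (H2.basis β k)) =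
      ((√(β.seq j) : ℝ) : ℂ) * ((√(β.seq k) : ℝ) : ℂ)⁻¹ * m j k := by
  have h : IsTaylor (fun j => ((√(β.seq k) : ℝ) : ℂ)⁻¹ * m j k) (T (H2.basis β k)) := by
    intro z
    rw [hT, H2.basis_apply]
    simpa only [mul_assoc] using (hm k z).mul_left ((√(β.seq k) : ℝ) : ℂ)⁻¹
  rw [H2.inner_basis, H2.coeff_eq_of_isTaylor h, mul_assoc]

/-- With `μ k = log √(β_k / γ_k)`, conjugation by the diagonal `exp (μ k)` replaces the weight `β`
by `γ` in the matrix of a composition operator. -/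
theorem exp_log_sqrt_div (β γ : Weight) (j k : ℕ) :
    Complex.exp ((Real.log √(β.seq k / γ.seq k) : ℂ) - Real.log √(β.seq j / γ.seq j)) *
      (((√(β.seq j) : ℝ) : ℂ) * ((√(β.seq k) : ℝ) : ℂ)⁻¹) =
      ((√(γ.seq j) : ℝ) : ℂ) * ((√(γ.seq k) : ℝ) : ℂ)⁻¹ := by
  have hβ := fun i => Real.sqrt_pos.2 (β.pos i)
  have hγ := fun i => Real.sqrt_pos.2 (γ.pos i)
  have h : ∀ i, Real.exp (Real.log √(β.seq i / γ.seq i)) = √(β.seq i) / √(γ.seq i) := fun i => by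
    rw [Real.exp_log (Real.sqrt_pos.2 (div_pos (β.pos i) (γ.pos i))), Real.sqrt_div (β.pos i).le]
  rw [← Complex.ofReal_sub, ← Complex.ofReal_exp, Real.exp_sub, h, h]
  have h1 := (hβ j).ne'
  have h2 := (hβ k).ne'
  have h3 := (hγ j).ne'
  have h4 := (hγ k).ne'
  norm_cast
  field_simp

/-- `GramDetBound.of_scaled` needs an operator that is already bounded. Boundedness of `S` is
therefore obtained beforehand, from the interpolation bound of order `1` on finite sections. -/
theorem IsCompositionOperator.exists_of_monotone_div {β γ : Weight}
    (hmono : Monotone fun k => β.seq k / γ.seq k)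
    (hφ : DifferentiableOn ℂ φ (Metric.ball 0 1))
    (hmaps : Set.MapsTo φ (Metric.ball 0 1) (Metric.ball 0 1)) (h0 : φ 0 = 0)
    {T : H2 β →L[ℂ] H2 β} (hT : IsCompositionOperator hmaps.restrict T) :
    ∃ S : H2 γ →L[ℂ] H2 γ, IsCompositionOperator hmaps.restrict S ∧ ‖S‖ ≤ ‖T‖ ∧
      ∀ n K, 0 ≤ K → GramDetBound T n K → GramDetBound S n K := by
  have hpow : ∀ k, ∃ c, IsTaylor c fun z : Disk => φ z ^ k := fun k => exists_isTaylor (hφ.pow k)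
  choose m' hm' using hpow
  let m : ℕ → ℕ → ℂ := fun j k => m' k j
  have hm : ∀ k, IsTaylor (fun j => m j k) fun z => φ z ^ k := hm'
  have hcomp := fun (f : H2 γ) => f.isTaylor.exists_comp hφ hmaps h0 hm
  let μ : ℕ → ℝ := fun k => Real.log √(β.seq k / γ.seq k)
  have hμmono : Monotone μ := fun j k hjk =>
    Real.log_le_log (Real.sqrt_pos.2 (div_pos (β.pos j) (γ.pos j))) (Real.sqrt_le_sqrt (hmono hjk))
  have hin : ∀ j k, inner ℂ (H2.basis β j) (T (H2.basis β k)) =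
      ((√(β.seq j) : ℝ) : ℂ) * ((√(β.seq k) : ℝ) : ℂ)⁻¹ * m j k := hT.inner_basis hm
  have hlower : ∀ j k, j < k → m j k = 0 := by
    intro j k hjk
    have hk : IsTaylor (fun i => if i = k then 1 else 0) fun z : Disk => (z : ℂ) ^ k := fun z => by
      simpa using hasSum_single (f := fun i => (if i = k then (1 : ℂ) else 0) * (z : ℂ) ^ i) k
        fun i hi => by simp [hi]
    -- Applied to `f = z ^ k` with `N = k`: none of the first `k` coefficients of `f` is nonzero.
    obtain ⟨b, hb, hbm⟩ := hk.exists_comp hφ hmaps h0 hm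
    have h1 : b = fun j => m j k := hb.unique (hm k)
    have h2 := hbm k j hjk
    rw [h1] at h2
    refine h2.trans (Finset.sum_eq_zero fun i hi => ?_)
    simp [(Finset.mem_range.1 hi).ne]
  have hμ : ∀ j k, inner ℂ (H2.basis β j) (T (H2.basis β k)) ≠ 0 → μ k ≤ μ j := by
    intro j k hne
    refine hμmono (le_of_not_gt fun hjk => hne ?_)
    rw [hin, hlower j k hjk, mul_zero]
  have hT1 : GramDetBound T 1 ‖T‖ := by
    simpa [approximationNumber_one] using gramDetBound_prod_approximationNumber T 1
  have hnorm : ∀ f : H2 γ, ∃ G : H2 γ,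
      (∀ z, G z = f (hmaps.restrict _ _ _ z)) ∧ ‖G‖ ≤ ‖T‖ * ‖f‖ := by
    intro f
    obtain ⟨b, hb, hbm⟩ := hcomp f
    refine H2.exists_of_sum_le hb (by positivity) fun N => ?_
    rw [← H2.sq_norm_eq_sum]
    set y : EuclideanSpace ℂ (Fin N) := WithLp.toLp 2 fun k => ((√(γ.seq k) : ℝ) : ℂ) * b k with hy
    set x : EuclideanSpace ℂ (Fin N) :=
      WithLp.toLp 2 fun k => ((√(γ.seq k) : ℝ) : ℂ) * f.coeff k with hx
    have hxf : ‖x‖ ≤ ‖f‖ := by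
      refine le_of_sq_le_sq ?_ (norm_nonneg _)
      rw [hx, H2.sq_norm_eq_sum, H2.norm_sq]
      exact f.summable.sum_le_tsum _ fun k _ => mul_nonneg (γ.pos k).le (sq_nonneg _)
    have h1 := norm_det_formMatrix_scaled_le (μ := fun k : Fin N => μ k) (fun j k h => hμ j k h)
      (hT1.norm_det_formMatrix_le (H2.basis β).orthonormal N) (fun _ => x) (fun _ => y)
    -- By triangularity the first `N` coefficients of `f ∘ φ` involve only the first `N` of `f`.
    -- Hence the scaled section sends `x` to `y`, and testing against `y` gives `‖y‖ ^ 2 ≤ ‖T‖ * ‖x‖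
    -- * ‖y‖`.
    have h2 : formMatrix (fun j k : Fin N => Complex.exp ((μ k : ℂ) - μ j) *
        inner ℂ (H2.basis β j) (T (H2.basis β k))) (fun _ : Fin 1 => x) (fun _ => y) 0 0 =
        ((‖y‖ ^ 2 : ℝ) : ℂ) := by
      rw [EuclideanSpace.norm_sq_eq, Complex.ofReal_sum]
      simp only [formMatrix, Matrix.of_apply]
      refine Finset.sum_congr rfl fun j _ => ?_
      have hyj : y j = ((√(γ.seq j) : ℝ) : ℂ) * ∑ k : Fin N, m j k * f.coeff k := by
        rw [← Finset.sum_range (fun k => m j k * f.coeff k), ← hbm N j j.2]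
      rw [Complex.ofReal_pow, ← Complex.conj_mul', starRingEnd_apply]
      nth_rewrite 3 [hyj]
      rw [Finset.mul_sum, Finset.mul_sum]
      refine Finset.sum_congr rfl fun k _ => ?_
      have hγk := H2.sqrt_ne_zero γ k
      have hxk : x k = ((√(γ.seq k) : ℝ) : ℂ) * f.coeff k := rfl
      rw [hin, ← mul_assoc (Complex.exp _), exp_log_sqrt_div, hxk]
      field_simp
    rw [Matrix.det_fin_one, h2] at h1
    simp only [Fin.prod_univ_one] at h1
    rw [Complex.norm_real, Real.norm_of_nonneg (sq_nonneg _)] at h1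
    have h3 : ‖y‖ ≤ ‖T‖ * ‖f‖ := by
      rcases (norm_nonneg y).eq_or_lt with hy0 | hy0
      · rw [← hy0]; positivity
      · refine le_of_mul_le_mul_right ?_ hy0
        calc ‖y‖ * ‖y‖ = ‖y‖ ^ 2 := (sq _).symm
          _ ≤ ‖T‖ * (‖x‖ * ‖y‖) := h1
          _ ≤ ‖T‖ * (‖f‖ * ‖y‖) := by gcongr
          _ = _ := by ring
    gcongr
  obtain ⟨S, hS, hSn⟩ := H2.exists_clm (fun (f : H2 γ) z => f (hmaps.restrict _ _ _ z))
    (fun _ _ _ => rfl) (fun _ _ _ => rfl) (norm_nonneg T) hnorm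
  have hS' : IsCompositionOperator hmaps.restrict S := hS
  refine ⟨S, hS', hSn, fun n K hK0 hK => ?_⟩
  refine hK.of_scaled hK0 (H2.basis β).orthonormal (H2.basis γ) hμ fun j k => ?_
  rw [hin, hS'.inner_basis hm, ← mul_assoc, exp_log_sqrt_div]

end CompositionOperators

theorem theorem3p10 (β γ : Weight) (hmono : Monotone fun k => β.seq k / γ.seq k)
    (φ : ℂ → ℂ) (hφ : DifferentiableOn ℂ φ (Metric.ball 0 1))
    (hmaps : Set.MapsTo φ (Metric.ball 0 1) (Metric.ball 0 1)) (h0 : φ 0 = 0) :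
    -- the continuous inclusion of `H²(β)` in `H²(γ)`
    (∃ ι : H2 β →L[ℂ] H2 γ, ∀ (f : H2 β) (z : Disk), ι f z = f z) ∧
    ∀ Tβ : H2 β →L[ℂ] H2 β, IsCompositionOperator hmaps.restrict Tβ →
      ∃ Tγ : H2 γ →L[ℂ] H2 γ, IsCompositionOperator hmaps.restrict Tγ ∧
        ‖Tγ‖ ≤ ‖Tβ‖ ∧
        (IsCompactOperator Tβ → IsCompactOperator Tγ) ∧
        -- singular numbers of compact operators, through the Schmidt decompositions
        (IsCompactOperator Tβ → ∀ sβ sγ : ℕ → ℝ, IsSingularNumbers Tβ sβ →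
          IsSingularNumbers Tγ sγ →
            LogSubordinate sγ sβ ∧ ∀ n ≥ 1, sγ (2 * n) ≤ √(sβ 1) * √(sβ n)) ∧
        -- the same for the approximation numbers of all bounded operators
        LogSubordinate (approximationNumber Tγ) (approximationNumber Tβ) ∧
        (∀ n ≥ 1, approximationNumber Tγ (2 * n) ≤
          √(approximationNumber Tβ 1) * √(approximationNumber Tβ n)) ∧
        ∀ p : ℝ, 0 < p → MemSchatten p Tβ → MemSchatten p Tγ := by
  refine ⟨H2.exists_inclusion β γ hmono, fun Tβ hTβ => ?_⟩
  obtain ⟨Tγ, hTγ, hnorm, hdet⟩ := hTβ.exists_of_monotone_div hmono hφ hmaps h0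
  have hlog : LogSubordinate (approximationNumber Tγ) (approximationNumber Tβ) := by
    intro n _
    have hK0 : 0 ≤ ∏ j ∈ Finset.Icc 1 n, approximationNumber Tβ j :=
      Finset.prod_nonneg fun _ _ => approximationNumber_nonneg _ _
    exact prod_approximationNumber_le Tγ n _ hK0
      (hdet n _ hK0 (gramDetBound_prod_approximationNumber Tβ n))
  have htwo : ∀ n ≥ 1, approximationNumber Tγ (2 * n) ≤
      √(approximationNumber Tβ 1) * √(approximationNumber Tβ n) := fun n hn =>
    hlog.two_mul_le (approximationNumber_nonneg _) (approximationNumber_nonneg _)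
      (fun _ _ => approximationNumber_anti _) (fun _ _ => approximationNumber_anti _) hn
  -- Compactness of `Tβ` makes the right side of `htwo` tend to `0`, so `Tγ` is a norm limit of
  -- finite-rank operators.
  have hcompact : IsCompactOperator Tβ → IsCompactOperator Tγ := by
    intro hc
    refine isCompactOperator_of_approximationNumber fun ε hε => ?_
    have hlim : Filter.Tendsto
        (fun n => √(approximationNumber Tβ 1) * √(approximationNumber Tβ n)) Filter.atTop
        (nhds 0) := by
      simpa using (tendsto_approximationNumber_of_isCompactOperator hc).sqrt.const_mul
        √(approximationNumber Tβ 1)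
    obtain ⟨n, hn, hn1⟩ := ((hlim.eventually (gt_mem_nhds hε)).and
      (Filter.eventually_ge_atTop 1)).exists
    exact ⟨2 * n, by omega, (htwo n hn1).trans_lt hn⟩
  refine ⟨Tγ, hTγ, hnorm, hcompact, fun _ sβ sγ hsβ hsγ => ⟨fun n hn => ?_, fun n hn => ?_⟩,
    hlog, htwo, fun p hp hS => ⟨hcompact hS.1, ?_⟩⟩
  · rw [Finset.prod_congr rfl fun j hj => hsγ.eq_approximationNumber (Finset.mem_Icc.1 hj).1,
      Finset.prod_congr rfl fun j hj => hsβ.eq_approximationNumber (Finset.mem_Icc.1 hj).1]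
    exact hlog n hn
  · rw [hsγ.eq_approximationNumber (by omega), hsβ.eq_approximationNumber le_rfl,
      hsβ.eq_approximationNumber hn]
    exact htwo n hn
  · exact hlog.summable_rpow (approximationNumber_nonneg _) (approximationNumber_nonneg _)
      (fun _ _ => approximationNumber_anti _) hp hS.2
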